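/- Let $d\ge 1$, let $\mu$ be a probability measure on $\mathbb{Z}^d$ with $n$-fold convolution powers $\mu^{(n)}$, and let $(B_n)$ be a sequence of $d\times d$ integer matrices, invertible over $\mathbb{R}$, such that $B_n^{-1}\mu^{(n)}$ (the image of $\mu^{(n)}$ under $x\mapsto B_n^{-1}x$) converges weakly to a probability measure $\eta$ on $\mathbb{R}^d$ that is adapted, i.e. $\eta(V)\neq 1$ for every proper linear subspace $V\subsetneq\mathbb{R}^d$. Let $F:[0,\infty)\to[0,\infty)$ be concave, sub-additive and non-decreasing with $F(0)=0$, let $(a_n)$ be a non-decreasing sequence of non-negative integers, and let $\widetilde F:[0,\infty)\to[0,\infty)$ be a function, not identically zero on $(0,\infty)$, such that $$\lim_{n\to\infty}\frac{a_n\,|\det B_{a_n}|}{n}\,F\!\left(\frac{n}{|\det B_{a_n}|}\,y\right)=\widetilde F(y)$$ uniformly for $y$ in compact subsets of $(0,\infty)$. Then there exists $\gamma\in[0,1]$ such that $$\widetilde F(y)=\widetilde F(1)\,y^{\gamma}\qquad\text{for all } y>0 .$$ Moreover, there exists $\kappa\ge 0$, with $\kappa>0$ whenever $\gamma<1$, such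 that $$\lim_{n\to\infty}\frac{a_{\lfloor \lambda n\rfloor}}{a_n}=\lambda^{\kappa}\quad\text{for all }\lambda>0,\qquad\text{and}\qquad \lim_{n\to\infty}\frac{\log a_n}{\log n}=\kappa .$$ -/

import Mathlib

open MeasureTheory Filter Topology Set

noncomputable section

namespace OccupationScaling

/-- The `n`-fold convolution power `μ^{(n)}` of a probability measure on `ℤ^d`
(the law at time `n` of the random walk started at `0` and driven by `μ`). -/
def convPow {d : ℕ} (μ : ProbabilityMeasure (Fin d → ℤ)) :
    ℕ → ProbabilityMeasure (Fin d → ℤ)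
  | 0 => ⟨Measure.dirac 0, inferInstance⟩
  | n + 1 => ⟨(convPow μ n : Measure (Fin d → ℤ)).conv (μ : Measure (Fin d → ℤ)), inferInstance⟩

/-- The linear map `x ↦ B⁻¹ x` from `ℤ^d` to `ℝ^d`, where `B` is an integer matrix (the inverse
is that of the real matrix). -/
def invApply {d : ℕ} (B : Matrix (Fin d) (Fin d) ℤ) (x : Fin d → ℤ) :
    EuclideanSpace ℝ (Fin d) :=
  WithLp.toLp 2 ((B.map (fun k : ℤ => (k : ℝ)))⁻¹.mulVec (fun i => (x i : ℝ)))

/-- The image measure `B⁻¹ ν` on `ℝ^d` of a probability measure `ν` on `ℤ^d`. -/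
def invMap {d : ℕ} (B : Matrix (Fin d) (Fin d) ℤ) (ν : ProbabilityMeasure (Fin d → ℤ)) :
    ProbabilityMeasure (EuclideanSpace ℝ (Fin d)) :=
  ν.map (f := invApply B) (measurable_of_countable _).aemeasurable

/-- A probability measure on `ℝ^d` is adapted if no proper linear subspace carries it. -/
def Adapted {d : ℕ} (η : ProbabilityMeasure (EuclideanSpace ℝ (Fin d))) : Prop :=
  ∀ V : Submodule ℝ (EuclideanSpace ℝ (Fin d)), V ≠ ⊤ →
    (η : Measure (EuclideanSpace ℝ (Fin d))) (V : Set (EuclideanSpace ℝ (Fin d))) ≠ 1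

/-- The convergence assumption (C-`B_n`): the integer matrices `B_n` are invertible (over the
reals) and `B_n⁻¹ μ^{(n)}` converges weakly to `η`. -/
structure ConvergenceAssumption {d : ℕ} (μ : ProbabilityMeasure (Fin d → ℤ))
    (B : ℕ → Matrix (Fin d) (Fin d) ℤ)
    (η : ProbabilityMeasure (EuclideanSpace ℝ (Fin d))) : Prop where
  det_ne_zero : ∀ n, (B n).det ≠ 0
  tendsto : Tendsto (fun n => invMap (B n) (convPow μ n)) atTop (𝓝 η)

/-- `|det B|` as a real number. -/
def absDet {d : ℕ} (B : Matrix (Fin d) (Fin d) ℤ) : ℝ := |((B.det : ℤ) : ℝ)|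

/-- The scaling assumption (S-`B_n`-`a_n`) for `F : [0,∞) → [0,∞)` with limit function
`F' : [0,∞) → [0,∞)`. Both are real functions of which only the restrictions to `[0,∞)`
matter. -/
structure ScalingAssumption {d : ℕ} (B : ℕ → Matrix (Fin d) (Fin d) ℤ) (F : ℝ → ℝ)
    (a : ℕ → ℕ) (F' : ℝ → ℝ) : Prop where
  nonneg : ∀ x, 0 ≤ x → 0 ≤ F x
  concave : ConcaveOn ℝ (Ici 0) F
  subadditive : ∀ x y, 0 ≤ x → 0 ≤ y → F (x + y) ≤ F x + F y
  monotone : MonotoneOn F (Ici 0)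
  map_zero : F 0 = 0
  monotone_seq : Monotone a
  limit_nonneg : ∀ y, 0 ≤ y → 0 ≤ F' y
  limit_ne_zero : ∃ y, 0 < y ∧ F' y ≠ 0
  tendsto : ∀ K : Set ℝ, IsCompact K → K ⊆ Ioi 0 →
    TendstoUniformlyOn
      (fun (n : ℕ) (y : ℝ) =>
        ((a n : ℝ) * absDet (B (a n)) / (n : ℝ)) * F ((n : ℝ) / absDet (B (a n)) * y))
      F' atTop K

end OccupationScaling

end

/-! The proof has two halves: `|det B_n|` is regularly varying, and then so is `a_n`, which forces
`F'` to be a power. For the determinants, let `P` be the law of one step on `ℝ^d` and `T_n =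
(B_n⁻¹)ᵀ`. The `n`-th power of the characteristic function of `P` at `T_n x` converges, uniformly on
balls, to that of `η`. With `ψ_n` its logarithm near `0`, `T_m y = T_n x` implies `ψ_m y / m = ψ_n x
/ n`. Hence `T_m⁻¹ T_n` carries `{|ψ_n| ≤ ε}` onto `{|ψ_m| ≤ (m/n) ε}`. Comparing volumes gives
`|det B_m| / |det B_n|`, which converges when `m/n` does (`exists_regVar_of_tendstoUniformlyOn`).
Adaptedness keeps the limit logarithm from vanishing along a whole radius; the star-shaped sublevel
sets therefore stay inside the ball. For the second half, `|det B_n|` has some index `δ ≥ 0`. If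
`m/n → l`, a cluster point `ρ` of `a_m / a_n` satisfies `F'(u y) ρ / u = F'(y)` with `u = l / ρ^δ`
(`limit_functional_equation`). As `F'(u)/u` is nonincreasing, this determines `ρ`, so `a` is
regularly varying with some index `κ`. Substituting `ρ = l^κ` exhibits `F'` as a power. A bounded
`a` is eventually constant; then `F'` is linear and `κ = 0`. -/

namespace OccupationScaling

/-! ### Continuous roots and star-shaped sublevel sets -/

section Sublevel

variable {E : Type*} [NormedAddCommGroup E] [NormedSpace ℝ E]

/-- A continuous `n`-th root, equal to `1` at `0`, of a function close to `1` on a ball is given by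
the principal logarithm. -/
lemma eq_exp_log_pow_div {f : E → ℂ} {r : ℝ} (hr : 0 ≤ r) {n : ℕ} (hn : n ≠ 0)
    (hf : ContinuousOn f (Metric.closedBall 0 r)) (h0 : f 0 = 1)
    (h : ∀ x ∈ Metric.closedBall (0 : E) r, ‖f x ^ n - 1‖ ≤ 1 / 2) :
    ∀ x ∈ Metric.closedBall (0 : E) r, f x = Complex.exp (Complex.log (f x ^ n) / n) := by
  have hn' : (n : ℂ) ≠ 0 := Nat.cast_ne_zero.2 hn
  have hslit : ∀ x ∈ Metric.closedBall (0 : E) r, f x ^ n ∈ Complex.slitPlane := by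
    intro x hx
    have := Complex.mem_slitPlane_of_norm_lt_one (z := f x ^ n - 1)
      (lt_of_le_of_lt (h x hx) (by norm_num))
    simpa using this
  -- The quotient of the two roots takes values in the finite set of `n`-th roots of unity, so it is
  -- constant on the connected ball.
  set g : E → ℂ := fun x => f x * Complex.exp (-(Complex.log (f x ^ n) / n)) with hg
  have hgc : ContinuousOn g (Metric.closedBall 0 r) :=
    hf.mul (((hf.pow n).clog hslit).div_const _).neg.cexp
  have hgn : ∀ x ∈ Metric.closedBall (0 : E) r, g x ∈ {z : ℂ | z ^ n = 1} := by
    intro x hx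
    have hne : f x ^ n ≠ 0 := Complex.slitPlane_ne_zero (hslit x hx)
    have e : (n : ℂ) * -(Complex.log (f x ^ n) / n) = -Complex.log (f x ^ n) := by
      field_simp
    simp only [hg, mem_ofPred_eq, mul_pow, ← Complex.exp_nat_mul]
    rw [e, Complex.exp_neg, Complex.exp_log hne, mul_inv_cancel₀ hne]
  have hfin : {z : ℂ | z ^ n = 1}.Finite := by
    refine (Polynomial.nthRootsFinset n (1 : ℂ)).finite_toSet.subset fun z hz => ?_
    simpa [Polynomial.mem_nthRootsFinset (Nat.pos_of_ne_zero hn)] using hz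
  have hconn : IsPreconnected (Metric.closedBall (0 : E) r) :=
    (convex_closedBall 0 r).isPreconnected
  have hdisc : IsDiscrete {z : ℂ | z ^ n = 1} := hfin.isDiscrete
  intro x hx
  have hx0 : g x = g 0 :=
    hconn.constant_of_mapsTo hdisc hgc hgn hx (Metric.mem_closedBall_self hr)
  have hg0 : g 0 = 1 := by simp [hg, h0]
  rw [hg0] at hx0
  have hx1 : f x * Complex.exp (-(Complex.log (f x ^ n) / n)) = 1 := hx0
  rw [Complex.exp_neg] at hx1
  exact (mul_inv_eq_one₀ (Complex.exp_ne_zero _)).1 hx1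

/-- The points `x` of the ball of radius `r` such that `‖ψ‖ ≤ ε` on the segment `[0, x]`. -/
def starSublevel (ψ : E → ℂ) (r ε : ℝ) : Set E :=
  {x | ‖x‖ ≤ r ∧ ∀ s ∈ Icc (0 : ℝ) 1, ‖ψ (s • x)‖ ≤ ε}

lemma norm_smul_le_of_mem_Icc {s r : ℝ} {x : E} (hs : s ∈ Icc (0 : ℝ) 1) (hx : ‖x‖ ≤ r) :
    ‖s • x‖ ≤ r := by
  rw [norm_smul, Real.norm_of_nonneg hs.1]
  nlinarith [hs.1, hs.2, norm_nonneg x]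

lemma starSublevel_subset {ψ χ : E → ℂ} {r ε ε' τ : ℝ} (h : ∀ x, ‖x‖ ≤ r → ‖ψ x - χ x‖ ≤ τ)
    (hε : ε + τ ≤ ε') : starSublevel ψ r ε ⊆ starSublevel χ r ε' := by
  rintro x ⟨hx, hs⟩
  refine ⟨hx, fun s hs' => ?_⟩
  have h1 := h (s • x) (norm_smul_le_of_mem_Icc hs' hx)
  have h2 := hs s hs'
  have h3 : ‖χ (s • x)‖ ≤ ‖ψ (s • x)‖ + ‖ψ (s • x) - χ (s • x)‖ := by
    simpa using norm_sub_le (ψ (s • x)) (ψ (s • x) - χ (s • x))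
  linarith

lemma starSublevel_mono {ψ : E → ℂ} {r ε ε' : ℝ} (h : ε ≤ ε') :
    starSublevel ψ r ε ⊆ starSublevel ψ r ε' :=
  starSublevel_subset (τ := 0) (by simp) (by linarith)

/-- If `ψ` and `χ` are proportional along `S` and `χ` is bounded below on rays through the sphere,
then `S` maps sublevel sets to sublevel sets. -/
lemma image_starSublevel_subset {ψ χ : E → ℂ} {r ε c q : ℝ} (S : E →ₗ[ℝ] E) (hr : 0 < r)
    (hq : 0 < q)
    (hS : ∀ x, ‖x‖ ≤ r → ‖S x‖ ≤ r → χ (S x) = q * ψ x)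
    (hχ : ∀ x, ‖x‖ = r → ∃ s ∈ Icc (0 : ℝ) 1, c ≤ ‖χ (s • x)‖) (hε : q * ε < c) :
    S '' starSublevel ψ r ε ⊆ starSublevel χ r (q * ε) := by
  rintro _ ⟨x, ⟨hx, hs⟩, rfl⟩
  have key : ∀ s ∈ Icc (0 : ℝ) 1, ‖s • S x‖ ≤ r → ‖χ (s • S x)‖ ≤ q * ε := by
    intro s hs' hle
    rw [← map_smul] at hle ⊢
    rw [hS _ (norm_smul_le_of_mem_Icc hs' hx) hle, norm_mul, Complex.norm_real,
      Real.norm_of_nonneg hq.le]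
    exact mul_le_mul_of_nonneg_left (hs s hs') hq.le
  -- If `S x` left the ball, its segment would cross the sphere; the bound `q * ε < c` up to that
  -- crossing contradicts `hχ`.
  have hSx : ‖S x‖ ≤ r := by
    by_contra! hlt
    have hpos : 0 < ‖S x‖ := hr.trans hlt
    have ht : r / ‖S x‖ ∈ Icc (0 : ℝ) 1 := ⟨by positivity, (div_le_one hpos).2 hlt.le⟩
    have hn : ‖(r / ‖S x‖) • S x‖ = r := by
      rw [norm_smul, Real.norm_of_nonneg ht.1, div_mul_cancel₀ _ hpos.ne']
    obtain ⟨s, hs', hc⟩ := hχ _ hn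
    have hle := norm_smul_le_of_mem_Icc hs' hn.le
    rw [smul_smul] at hle hc
    have := key (s * (r / ‖S x‖))
      ⟨mul_nonneg hs'.1 ht.1, mul_le_one₀ hs'.2 ht.1 ht.2⟩ hle
    linarith
  exact ⟨hSx, fun s hs' => key s hs' (norm_smul_le_of_mem_Icc hs' hSx)⟩

lemma exists_pos_le_norm_on_sphere [FiniteDimensional ℝ E] {ψ : E → ℂ} {r : ℝ}
    (hψ : ContinuousOn ψ (Metric.closedBall 0 r))
    (h : ∀ x, ‖x‖ = r → ∃ s ∈ Icc (0 : ℝ) 1, ψ (s • x) ≠ 0) :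
    ∃ c > 0, ∀ x, ‖x‖ = r → ∃ s ∈ Icc (0 : ℝ) 1, c ≤ ‖ψ (s • x)‖ := by
  have hK : IsCompact (Metric.sphere (0 : E) r) := isCompact_sphere 0 r
  have := hK.induction_on
    (p := fun A => ∃ c > 0, ∀ x ∈ A, ‖x‖ = r → ∃ s ∈ Icc (0 : ℝ) 1, c ≤ ‖ψ (s • x)‖)
    ⟨1, one_pos, by simp⟩
    (fun A A' hA ⟨c, hc, h'⟩ => ⟨c, hc, fun x hx => h' x (hA hx)⟩)
    (fun A A' ⟨c, hc, h1⟩ ⟨c', hc', h2⟩ => ⟨min c c', lt_min hc hc', fun x hx hxr => by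
      rcases hx with hx | hx
      · obtain ⟨s, hs, hle⟩ := h1 x hx hxr
        exact ⟨s, hs, (min_le_left _ _).trans hle⟩
      · obtain ⟨s, hs, hle⟩ := h2 x hx hxr
        exact ⟨s, hs, (min_le_right _ _).trans hle⟩⟩)
    (fun x hx => by
      have hxr : ‖x‖ = r := by simpa using hx
      obtain ⟨s, hs, hne⟩ := h x hxr
      have hcont : ContinuousOn (fun y => ‖ψ (s • y)‖) (Metric.sphere (0 : E) r) := by
        refine (hψ.comp (continuous_const_smul s).continuousOn fun y hy => ?_).norm
        have : ‖y‖ = r := by simpa using hy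
        simpa using norm_smul_le_of_mem_Icc hs this.le
      have hpos : 0 < ‖ψ (s • x)‖ := norm_pos_iff.2 hne
      refine ⟨_, (hcont x hx).eventually (lt_mem_nhds (half_lt_self hpos)),
        ‖ψ (s • x)‖ / 2, half_pos hpos, fun y hy _ => ⟨s, hs, le_of_lt hy⟩⟩)
  obtain ⟨c, hc, h'⟩ := this
  exact ⟨c, hc, fun x hx => h' x (by simpa using hx) hx⟩

end Sublevel

/-! ### Regular variation of sequences -/

/-- `f (m k) / f (n k) → g θ` whenever `m k, n k → ∞` and `m k / n k → θ > 0`. -/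
def RegVar (f : ℕ → ℝ) (g : ℝ → ℝ) : Prop :=
  ∀ θ : ℝ, 0 < θ → ∀ m n : ℕ → ℕ, Tendsto m atTop atTop → Tendsto n atTop atTop →
    Tendsto (fun k => (m k : ℝ) / n k) atTop (𝓝 θ) →
    Tendsto (fun k => f (m k) / f (n k)) atTop (𝓝 (g θ))

lemma tendsto_floor_mul {θ : ℝ} (hθ : 0 < θ) :
    Tendsto (fun k : ℕ => ⌊θ * k⌋₊) atTop atTop :=
  tendsto_nat_floor_atTop.comp (tendsto_natCast_atTop_atTop.const_mul_atTop hθ)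

lemma tendsto_floor_mul_div {θ : ℝ} (hθ : 0 < θ) :
    Tendsto (fun k : ℕ => (⌊θ * k⌋₊ : ℝ) / k) atTop (𝓝 θ) :=
  (tendsto_nat_floor_mul_div_atTop hθ.le).comp tendsto_natCast_atTop_atTop

lemma RegVar.mul {f : ℕ → ℝ} {g : ℝ → ℝ} (h : RegVar f g) (hf : ∀ᶠ n in atTop, f n ≠ 0)
    {x y : ℝ} (hx : 0 < x) (hy : 0 < y) : g (x * y) = g x * g y := by
  have hxy := mul_pos hx hy
  have h1 := h (x * y) hxy _ _ (tendsto_floor_mul hxy) tendsto_id (tendsto_floor_mul_div hxy)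
  have h2 := h y hy _ _ (tendsto_floor_mul hy) tendsto_id (tendsto_floor_mul_div hy)
  have h3 : Tendsto (fun k : ℕ => (⌊x * y * k⌋₊ : ℝ) / ⌊y * k⌋₊) atTop (𝓝 x) := by
    have := (tendsto_floor_mul_div hxy).div (tendsto_floor_mul_div hy) hy.ne'
    rw [mul_div_cancel_right₀ _ hy.ne'] at this
    refine this.congr' ?_
    filter_upwards [eventually_gt_atTop 0] with k hk
    have : (k : ℝ) ≠ 0 := by positivity
    simp only [Pi.div_apply]
    rw [div_div_div_cancel_right₀ this]
  have h4 := h x hx _ _ (tendsto_floor_mul hxy) (tendsto_floor_mul hy) h3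
  refine tendsto_nhds_unique (h1.congr' ?_) (h4.mul h2)
  filter_upwards [(tendsto_floor_mul hy).eventually hf] with k hk
  simp only [id]
  rw [div_mul_div_cancel₀ hk]

lemma RegVar.one {f : ℕ → ℝ} {g : ℝ → ℝ} (h : RegVar f g) (hf : ∀ᶠ n in atTop, f n ≠ 0) :
    g 1 = 1 := by
  have h1 := h 1 one_pos id id tendsto_id tendsto_id
    (tendsto_const_nhds.congr' (by
      filter_upwards [eventually_gt_atTop 0] with k hk
      have : (k : ℝ) ≠ 0 := by positivity
      simp [this]))
  refine tendsto_nhds_unique h1 (tendsto_const_nhds.congr' ?_)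
  filter_upwards [hf] with k hk
  simp [hk]

/-- A multiplicative function on `(0, ∞)` bounded away from `0` on `[1, ∞)` is a nonnegative
power. -/
lemma exists_rpow_of_mul {g : ℝ → ℝ} (h1 : g 1 = 1)
    (hmul : ∀ x y, 0 < x → 0 < y → g (x * y) = g x * g y) {c : ℝ} (hc : 0 < c)
    (hg : ∀ x, 1 ≤ x → c ≤ g x) : ∃ κ : ℝ, 0 ≤ κ ∧ ∀ x, 0 < x → g x = x ^ κ := by
  have hpos1 : ∀ x, 1 ≤ x → 0 < g x := fun x hx => hc.trans_le (hg x hx)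
  have hge : ∀ x, 1 ≤ x → 1 ≤ g x := by
    intro x hx
    by_contra! hlt
    -- A value below `1` would have powers, again values of `g` on `[1, ∞)`, tending to `0`.
    have hpow : ∀ k : ℕ, g (x ^ k) = g x ^ k := by
      intro k
      induction k with
      | zero => simpa using h1
      | succ k ih => rw [pow_succ, hmul _ _ (by positivity) (by positivity), ih, pow_succ]
    obtain ⟨k, hk⟩ := exists_pow_lt_of_lt_one hc hlt
    have := hg (x ^ k) (one_le_pow₀ hx)
    rw [hpow] at this
    linarith
  have hpos : ∀ x, 0 < x → 0 < g x := by
    intro x hx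
    rcases le_total 1 x with h | h
    · exact hpos1 x h
    · have hinv := hpos1 x⁻¹ ((one_le_inv₀ hx).2 h)
      have := hmul x x⁻¹ hx (inv_pos.2 hx)
      rw [mul_inv_cancel₀ hx.ne', h1] at this
      by_contra! hle
      nlinarith
  -- In logarithmic coordinates `g` is additive and monotone, hence measurable, hence continuous and
  -- linear.
  let G : ℝ →+ ℝ :=
    { toFun := fun t => Real.log (g (Real.exp t))
      map_zero' := by simp [h1]
      map_add' := fun s t => by
        rw [Real.exp_add, hmul _ _ (Real.exp_pos _) (Real.exp_pos _),
          Real.log_mul (hpos _ (Real.exp_pos _)).ne' (hpos _ (Real.exp_pos _)).ne'] }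
  have hGnonneg : ∀ t, 0 ≤ t → 0 ≤ G t := fun t ht =>
    Real.log_nonneg (hge _ (Real.one_le_exp ht))
  have hGmono : Monotone G := by
    intro s t hst
    have := hGnonneg (t - s) (sub_nonneg.2 hst)
    rw [map_sub] at this
    linarith
  have hGc : Continuous G := MeasureTheory.Measure.AddMonoidHom.continuous_of_measurable G hGmono.measurable
  have hlin : ∀ t, G t = t * G 1 := by
    intro t
    have := (G.toRealLinearMap hGc).map_smul t 1
    simpa using this
  refine ⟨G 1, hGnonneg 1 zero_le_one, fun x hx => ?_⟩
  have h2 := hlin (Real.log x)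
  have h3 : G (Real.log x) = Real.log (g x) := by
    change Real.log (g (Real.exp (Real.log x))) = _
    rw [Real.exp_log hx]
  rw [Real.rpow_def_of_pos hx, ← h2, h3, Real.exp_log (hpos x hx)]

lemma RegVar.exists_rpow {f : ℕ → ℝ} {g : ℝ → ℝ} (h : RegVar f g)
    (hf : ∀ᶠ n in atTop, 0 < f n) {C : ℝ} (hC : 0 < C)
    (hmono : ∀ᶠ m in atTop, ∀ n, m ≤ n → f m ≤ C * f n) :
    ∃ κ : ℝ, 0 ≤ κ ∧ RegVar f (fun x => x ^ κ) := by
  have hf' : ∀ᶠ n in atTop, f n ≠ 0 := hf.mono fun n hn => hn.ne'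
  obtain ⟨κ, hκ, hgκ⟩ := exists_rpow_of_mul (h.one hf') (fun x y hx hy => h.mul hf' hx hy)
    (inv_pos.2 hC) fun x hx => by
      have hx0 : 0 < x := one_pos.trans_le hx
      refine ge_of_tendsto (h x hx0 _ _ (tendsto_floor_mul hx0) tendsto_id
        (tendsto_floor_mul_div hx0)) ?_
      filter_upwards [hf, hmono] with k hk hm
      have hle : k ≤ ⌊x * k⌋₊ := Nat.le_floor (by nlinarith [Nat.cast_nonneg (α := ℝ) k])
      rw [id, inv_eq_one_div, div_le_div_iff₀ hC hk, one_mul, mul_comm]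
      exact hm _ hle
  refine ⟨κ, hκ, fun θ hθ m n hm hn hmn => ?_⟩
  simp only [← hgκ θ hθ]
  exact h θ hθ m n hm hn hmn

/-- Along powers of `2` the increments of `log f` tend to `κ log 2`, so Cesàro averaging applies;
monotonicity of `f` fills in between consecutive powers. -/
lemma RegVar.tendsto_log_div_log {f : ℕ → ℝ} {κ : ℝ} (h : RegVar f (fun x => x ^ κ))
    (hmono : Monotone f) (hf : ∀ᶠ n in atTop, 1 ≤ f n) :
    Tendsto (fun n : ℕ => Real.log (f n) / Real.log n) atTop (𝓝 κ) := by
  set b : ℕ → ℝ := fun k => Real.log (f (2 ^ k)) with hb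
  have hp : Tendsto (fun k : ℕ => 2 ^ k) atTop atTop := tendsto_pow_atTop_atTop_of_one_lt one_lt_two
  have hfp : ∀ᶠ k : ℕ in atTop, 1 ≤ f (2 ^ k) := hp.eventually hf
  have hlog2 : 0 < Real.log 2 := Real.log_pos one_lt_two
  have hdiff : Tendsto (fun k => b (k + 1) - b k) atTop (𝓝 (κ * Real.log 2)) := by
    have h2 : Tendsto (fun k : ℕ => ((2 ^ (k + 1) : ℕ) : ℝ) / ((2 ^ k : ℕ) : ℝ)) atTop (𝓝 2) := by
      refine tendsto_const_nhds.congr fun k => ?_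
      push_cast
      rw [pow_succ]
      field_simp
    have h1 := h 2 two_pos (fun k => 2 ^ (k + 1)) (fun k => 2 ^ k)
      ((tendsto_add_atTop_iff_nat 1).2 hp) hp h2
    have h3 := h1.log (by positivity)
    rw [Real.log_rpow two_pos] at h3
    refine h3.congr' ?_
    filter_upwards [hfp] with k hk
    have hk' : 1 ≤ f (2 ^ (k + 1)) := hk.trans (hmono (Nat.pow_le_pow_right two_pos k.le_succ))
    rw [Real.log_div (by linarith) (by linarith)]
  have hces := hdiff.cesaro
  have hbk : Tendsto (fun k : ℕ => b k / k) atTop (𝓝 (κ * Real.log 2)) := by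
    have h0 : Tendsto (fun k : ℕ => b 0 / k) atTop (𝓝 0) :=
      tendsto_const_nhds.div_atTop tendsto_natCast_atTop_atTop
    have := hces.add h0
    rw [add_zero] at this
    refine this.congr fun k => ?_
    rw [Finset.sum_range_sub]
    ring
  have hk1 : Tendsto (fun k : ℕ => (k : ℝ) / ((k : ℝ) + 1)) atTop (𝓝 1) :=
    tendsto_natCast_div_add_atTop 1
  have hlow : Tendsto (fun k : ℕ => b k / (((k : ℝ) + 1) * Real.log 2)) atTop (𝓝 κ) := by
    have := (hbk.mul hk1).div_const (Real.log 2)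
    rw [mul_one, mul_div_cancel_right₀ _ hlog2.ne'] at this
    refine this.congr' ?_
    filter_upwards [eventually_gt_atTop 0] with k hk
    have : (k : ℝ) ≠ 0 := by positivity
    field_simp
  have hup : Tendsto (fun k : ℕ => b (k + 1) / ((k : ℝ) * Real.log 2)) atTop (𝓝 κ) := by
    have := (((tendsto_add_atTop_iff_nat 1).2 hbk).div hk1 one_ne_zero).div_const (Real.log 2)
    rw [div_one, mul_div_cancel_right₀ _ hlog2.ne'] at this
    refine this.congr' ?_
    filter_upwards [eventually_gt_atTop 0] with k hk
    have : (k : ℝ) ≠ 0 := by positivity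
    have : (k : ℝ) + 1 ≠ 0 := by positivity
    simp only [Pi.div_apply]
    push_cast
    field_simp
  have hL : Tendsto (fun n : ℕ => Nat.log 2 n) atTop atTop := by
    refine tendsto_atTop.2 fun k => ?_
    filter_upwards [eventually_ge_atTop (2 ^ k)] with n hn
    exact Nat.le_log_of_pow_le one_lt_two hn
  refine tendsto_of_tendsto_of_tendsto_of_le_of_le' (hlow.comp hL) (hup.comp hL) ?_ ?_
  · filter_upwards [hL.eventually hfp, eventually_ge_atTop 2] with n hn hn2
    have hn0 : n ≠ 0 := by omega
    have e1 : 2 ^ Nat.log 2 n ≤ n := Nat.pow_log_le_self 2 hn0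
    have e2 : n < 2 ^ (Nat.log 2 n + 1) := Nat.lt_pow_succ_log_self one_lt_two n
    have e3 : Real.log n ≤ ((Nat.log 2 n : ℝ) + 1) * Real.log 2 := by
      have : (n : ℝ) ≤ 2 ^ (Nat.log 2 n + 1) := by exact_mod_cast e2.le
      have := Real.log_le_log (by positivity) this
      rwa [Real.log_pow, Nat.cast_add_one] at this
    have hnlog : 0 < Real.log n := Real.log_pos (by exact_mod_cast hn2)
    have e4 : b (Nat.log 2 n) ≤ Real.log (f n) :=
      Real.log_le_log (by linarith) (hmono e1)
    exact div_le_div₀ (Real.log_nonneg (hn.trans (hmono e1))) e4 hnlog e3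
  · filter_upwards [hL.eventually hfp, eventually_ge_atTop 2] with n hn hn2
    have hn0 : n ≠ 0 := by omega
    have e1 : 2 ^ Nat.log 2 n ≤ n := Nat.pow_log_le_self 2 hn0
    have e2 : n < 2 ^ (Nat.log 2 n + 1) := Nat.lt_pow_succ_log_self one_lt_two n
    have hfn : 1 ≤ f n := hn.trans (hmono e1)
    have e3 : (Nat.log 2 n : ℝ) * Real.log 2 ≤ Real.log n := by
      have : (2 : ℝ) ^ (Nat.log 2 n) ≤ n := by exact_mod_cast e1
      have := Real.log_le_log (by positivity) this
      rwa [Real.log_pow] at this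
    have hl0 : 0 < Nat.log 2 n := Nat.log_pos one_lt_two hn2
    have e4 : Real.log (f n) ≤ b (Nat.log 2 n + 1) :=
      Real.log_le_log (by linarith) (hmono e2.le)
    exact div_le_div₀ ((Real.log_nonneg hfn).trans e4) e4 (by positivity) e3

/-! ### Volumes of sublevel sets and regular variation of determinants -/

section Volume

variable {E : Type*} [NormedAddCommGroup E] [NormedSpace ℝ E] [FiniteDimensional ℝ E]
  [MeasurableSpace E] [BorelSpace E] {μ : Measure E} [μ.IsAddHaarMeasure]

lemma measure_starSublevel_ne_top {ψ : E → ℂ} {r ε : ℝ} : μ (starSublevel ψ r ε) ≠ ⊤ := by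
  refine ne_top_of_le_ne_top (measure_closedBall_lt_top (μ := μ) (x := (0 : E)) (r := r)).ne
    (measure_mono fun x hx => ?_)
  simpa using hx.1

lemma measureReal_starSublevel_pos {ψ : E → ℂ} {r ε : ℝ} (hr : 0 < r) (hε : 0 < ε)
    (hψ : ContinuousOn ψ (Metric.closedBall 0 r)) (h0 : ψ 0 = 0) :
    0 < μ.real (starSublevel ψ r ε) := by
  have hc : ContinuousAt ψ 0 := hψ.continuousAt (Metric.closedBall_mem_nhds 0 hr)
  obtain ⟨δ, hδ, hball⟩ := Metric.continuousAt_iff.1 hc ε hε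
  have hρ : 0 < min δ r := lt_min hδ hr
  have hsub : Metric.ball (0 : E) (min δ r) ⊆ starSublevel ψ r ε := by
    intro x hx
    have hx' : ‖x‖ < min δ r := by simpa using hx
    refine ⟨(hx'.trans_le (min_le_right _ _)).le, fun s hs => ?_⟩
    have := hball (x := s • x) (by
      have h1 := norm_smul_le_of_mem_Icc hs (le_refl ‖x‖)
      have h2 := hx'.trans_le (min_le_left _ _)
      simpa using h1.trans_lt h2)
    rw [h0, dist_zero_right] at this
    exact this.le
  exact (ENNReal.toReal_pos (Metric.measure_ball_pos μ 0 hρ).ne' measure_ball_lt_top.ne).trans_le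
    (measureReal_mono hsub measure_starSublevel_ne_top)

/-- `T m⁻¹ ∘ T n` and its inverse map each sublevel set into the other, so the volumes differ by the
factor `|det|`. -/
lemma measureReal_starSublevel_eq {T : ℕ → E ≃ₗ[ℝ] E} {D : ℕ → ℝ} (hD : ∀ n, 0 < D n)
    (hTD : ∀ n, |LinearMap.det (T n : E →ₗ[ℝ] E)| = (D n)⁻¹) {ψ : ℕ → E → ℂ} {r c : ℝ} {N : ℕ}
    (hr : 0 < r)
    (hψ : ∀ m n, N ≤ m → N ≤ n → ∀ x y, ‖x‖ ≤ r → ‖y‖ ≤ r → T m y = T n x →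
      (n : ℂ) * ψ m y = m * ψ n x)
    (hc : ∀ n, N ≤ n → ∀ x, ‖x‖ = r → ∃ s ∈ Icc (0 : ℝ) 1, c ≤ ‖ψ n (s • x)‖)
    {m n : ℕ} (hm0 : 0 < m) (hn0 : 0 < n) (hm : N ≤ m) (hn : N ≤ n) {ε : ℝ} (hε : ε < c)
    (hε' : (m / n : ℝ) * ε < c) :
    μ.real (starSublevel (ψ m) r ((m / n : ℝ) * ε)) =
      D m / D n * μ.real (starSublevel (ψ n) r ε) := by
  have hm' : (m : ℝ) ≠ 0 := by positivity
  have hn' : (n : ℝ) ≠ 0 := by positivity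
  have hmC : (m : ℂ) ≠ 0 := Nat.cast_ne_zero.2 hm0.ne'
  have hnC : (n : ℂ) ≠ 0 := Nat.cast_ne_zero.2 hn0.ne'
  set S : E →ₗ[ℝ] E := ((T m).symm : E →ₗ[ℝ] E) ∘ₗ (T n : E →ₗ[ℝ] E) with hS
  set S' : E →ₗ[ℝ] E := ((T n).symm : E →ₗ[ℝ] E) ∘ₗ (T m : E →ₗ[ℝ] E) with hS'
  have hTS : ∀ x, T m (S x) = T n x := fun x => by simp [hS]
  have hTS' : ∀ x, T n (S' x) = T m x := fun x => by simp [hS']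
  have hSS' : ∀ x, S (S' x) = x := fun x => by simp [hS, hS']
  have h1 := image_starSublevel_subset (ψ := ψ n) (χ := ψ m) (r := r) (ε := ε) (c := c)
    (q := (m / n : ℝ)) S hr (by positivity) (fun x hx hy => by
      have := hψ m n hm hn x (S x) hx hy (hTS x)
      push_cast
      field_simp
      linear_combination this) (hc m hm) hε'
  have e2 : (n / m : ℝ) * ((m / n : ℝ) * ε) = ε := by field_simp
  have h2 := image_starSublevel_subset (ψ := ψ m) (χ := ψ n) (r := r) (ε := (m / n : ℝ) * ε)
    (c := c) (q := (n / m : ℝ)) S' hr (by positivity) (fun x hx hy => by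
      have := hψ n m hn hm x (S' x) hx hy (hTS' x)
      push_cast
      field_simp
      linear_combination this) (hc n hn) (by rwa [e2])
  rw [e2] at h2
  have himg : S '' starSublevel (ψ n) r ε = starSublevel (ψ m) r ((m / n : ℝ) * ε) := by
    refine h1.antisymm fun x hx => ⟨S' x, h2 ⟨x, hx, rfl⟩, hSS' x⟩
  have hdet : |LinearMap.det S| = D m / D n := by
    have e : LinearMap.det (T m : E →ₗ[ℝ] E) * LinearMap.det S =
        LinearMap.det (T n : E →ₗ[ℝ] E) := by
      rw [← LinearMap.det_comp]
      congr 1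
      ext x
      exact hTS x
    have e' := congrArg abs e
    rw [abs_mul, hTD, hTD] at e'
    have := hD m
    have := hD n
    field_simp at e' ⊢
    linarith
  rw [← himg, measureReal_def, Measure.addHaar_image_linearMap, ENNReal.toReal_mul, hdet,
    ENNReal.toReal_ofReal (div_pos (hD m) (hD n)).le, measureReal_def]

lemma tendsto_measureReal_starSublevel {ψ : ℕ → E → ℂ} {χ : E → ℂ} {r ε : ℝ}
    (hconv : TendstoUniformlyOn ψ χ atTop (Metric.closedBall 0 r))
    (hcont : ContinuousAt (fun ε => μ.real (starSublevel χ r ε)) ε)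
    {n : ℕ → ℕ} (hn : Tendsto n atTop atTop) {e : ℕ → ℝ} (he : Tendsto e atTop (𝓝 ε)) :
    Tendsto (fun k => μ.real (starSublevel (ψ (n k)) r (e k))) atTop
      (𝓝 (μ.real (starSublevel χ r ε))) := by
  refine Metric.tendsto_atTop'.2 fun η hη => ?_
  obtain ⟨τ, hτ, hb⟩ := Metric.continuousAt_iff.1 hcont η hη
  have h1 := hn.eventually (Metric.tendstoUniformlyOn_iff.1 hconv (τ / 3) (by positivity))
  have h2 := Metric.tendsto_nhds.1 he (τ / 3) (by positivity)
  obtain ⟨K, hK⟩ := eventually_atTop.1 (h1.and h2)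
  refine ⟨K, fun k hk => ?_⟩
  obtain ⟨hk1, hk2⟩ := hK k hk.le
  rw [Real.dist_eq, abs_lt] at hk2
  have hd : ∀ x, ‖x‖ ≤ r → ‖ψ (n k) x - χ x‖ ≤ τ / 3 := fun x hx => by
    rw [← dist_eq_norm, dist_comm]
    exact (hk1 x (by simpa using hx)).le
  have hd' : ∀ x, ‖x‖ ≤ r → ‖χ x - ψ (n k) x‖ ≤ τ / 3 := fun x hx => by
    rw [norm_sub_rev]
    exact hd x hx
  -- Of the slack `2 * τ / 3`, one third absorbs the error in `ψ` and the other the error in `e`.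
  have hup : μ.real (starSublevel (ψ (n k)) r (e k)) ≤ μ.real (starSublevel χ r (ε + 2 * τ / 3)) :=
    measureReal_mono (starSublevel_subset hd (by linarith)) measure_starSublevel_ne_top
  have hlo : μ.real (starSublevel χ r (ε - 2 * τ / 3)) ≤ μ.real (starSublevel (ψ (n k)) r (e k)) :=
    measureReal_mono (starSublevel_subset hd' (by linarith)) measure_starSublevel_ne_top
  have hb1 := hb (x := ε + 2 * τ / 3) (by
    rw [Real.dist_eq, abs_lt]; constructor <;> linarith)
  have hb2 := hb (x := ε - 2 * τ / 3) (by
    rw [Real.dist_eq, abs_lt]; constructor <;> linarith)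
  rw [Real.dist_eq, abs_lt] at hb1 hb2 ⊢
  constructor <;> linarith

theorem exists_regVar_of_tendstoUniformlyOn (μ : Measure E) [μ.IsAddHaarMeasure]
    {T : ℕ → E ≃ₗ[ℝ] E} {D : ℕ → ℝ} (hD : ∀ n, 0 < D n)
    (hTD : ∀ n, |LinearMap.det (T n : E →ₗ[ℝ] E)| = (D n)⁻¹) {ψ : ℕ → E → ℂ} {χ : E → ℂ}
    {r : ℝ} {N : ℕ} (hr : 0 < r)
    (hψ : ∀ m n, N ≤ m → N ≤ n → ∀ x y, ‖x‖ ≤ r → ‖y‖ ≤ r → T m y = T n x →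
      (n : ℂ) * ψ m y = m * ψ n x)
    (hconv : TendstoUniformlyOn ψ χ atTop (Metric.closedBall 0 r))
    (hχ : ContinuousOn χ (Metric.closedBall 0 r)) (hχ0 : χ 0 = 0)
    (hne : ∀ x, ‖x‖ = r → ∃ s ∈ Icc (0 : ℝ) 1, χ (s • x) ≠ 0) :
    (∃ C > 0, ∀ᶠ m in atTop, ∀ n, m ≤ n → D m ≤ C * D n) ∧ ∃ g, RegVar D g := by
  obtain ⟨c', hc'0, hc'⟩ := exists_pos_le_norm_on_sphere hχ hne
  -- Halving lets the lower bound for `χ` pass to `ψ n` once the uniform error is below `c`.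
  set c := c' / 2 with hcdef
  have hc0 : 0 < c := half_pos hc'0
  obtain ⟨N₁, hN₁⟩ := eventually_atTop.1 (Metric.tendstoUniformlyOn_iff.1 hconv c hc0)
  have hc : ∀ n, N₁ ≤ n → ∀ x, ‖x‖ = r → ∃ s ∈ Icc (0 : ℝ) 1, c ≤ ‖ψ n (s • x)‖ := by
    intro n hn x hx
    obtain ⟨s, hs, hle⟩ := hc' x hx
    refine ⟨s, hs, ?_⟩
    have h1 := hN₁ n hn (s • x) (by simpa using norm_smul_le_of_mem_Icc hs hx.le)
    rw [dist_eq_norm] at h1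
    have h2 := norm_sub_norm_le (χ (s • x)) (ψ n (s • x))
    linarith
  set N₂ := max (max N N₁) 1 with hN₂
  have hN : N ≤ N₂ := (le_max_left _ _).trans (le_max_left _ _)
  have hN1 : N₁ ≤ N₂ := (le_max_right _ _).trans (le_max_left _ _)
  have hpos : ∀ n, N₂ ≤ n → 0 < n := fun n hn => (le_max_right _ 1).trans hn
  have key : ∀ m n, N₂ ≤ m → N₂ ≤ n → ∀ ε, ε < c → (m / n : ℝ) * ε < c →
      μ.real (starSublevel (ψ m) r ((m / n : ℝ) * ε)) =
        D m / D n * μ.real (starSublevel (ψ n) r ε) := fun m n hm hn ε h1 h2 =>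
    measureReal_starSublevel_eq (N := N₂) hD hTD hr
      (fun m n hm hn => hψ m n (hN.trans hm) (hN.trans hn))
      (fun n hn => hc n (hN1.trans hn)) (hpos m hm) (hpos n hn) hm hn h1 h2
  have hVpos : ∀ ε, 0 < ε → 0 < μ.real (starSublevel χ r ε) := fun ε hε =>
    measureReal_starSublevel_pos hr hε hχ hχ0
  have hVmono : Monotone fun ε => μ.real (starSublevel χ r ε) := fun ε ε' h =>
    measureReal_mono (starSublevel_mono h) measure_starSublevel_ne_top
  constructor
  · set v := μ.real (starSublevel χ r (c / 4)) with hv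
    have hv0 : 0 < v := hVpos _ (by positivity)
    set w := μ.real (Metric.closedBall (0 : E) r) with hw
    have hw0 : 0 < w := by
      refine hv0.trans_le (measureReal_mono (fun x hx => ?_) measure_closedBall_lt_top.ne)
      simpa using hx.1
    -- In the volume identity at level `c / 2`, the set for `m` lies in the ball (volume `w`) and
    -- the set for `n` has volume at least `v`.
    refine ⟨w / v, by positivity, ?_⟩
    obtain ⟨N₃, hN₃⟩ := eventually_atTop.1
      (Metric.tendstoUniformlyOn_iff.1 hconv (c / 4) (by positivity))
    filter_upwards [eventually_ge_atTop (max N₂ N₃)] with m hm n hmn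
    have hm2 : N₂ ≤ m := (le_max_left _ _).trans hm
    have hn2 : N₂ ≤ n := hm2.trans hmn
    have hq : (m / n : ℝ) ≤ 1 := by
      have : (0 : ℝ) < n := Nat.cast_pos.2 (hpos n hn2)
      rw [div_le_one this]
      exact_mod_cast hmn
    have e := key m n hm2 hn2 (c / 2) (by linarith) (by nlinarith)
    have hvn : v ≤ μ.real (starSublevel (ψ n) r (c / 2)) := by
      refine measureReal_mono (starSublevel_subset (τ := c / 4) (fun x hx => ?_) (by linarith))
        measure_starSublevel_ne_top
      rw [← dist_eq_norm]
      exact (hN₃ n (((le_max_right _ _).trans hm).trans hmn) x (by simpa using hx)).le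
    have hwm : μ.real (starSublevel (ψ m) r ((m / n : ℝ) * (c / 2))) ≤ w :=
      measureReal_mono (fun x hx => by simpa using hx.1) measure_closedBall_lt_top.ne
    have hmul : D m / D n * v ≤ w :=
      (mul_le_mul_of_nonneg_left hvn (div_pos (hD m) (hD n)).le).trans (e ▸ hwm)
    rw [← le_div_iff₀ hv0, div_le_iff₀ (hD n)] at hmul
    exact hmul
  · have hlim : ∀ θ : ℝ, ∃ L : ℝ, 0 < θ → ∀ m n : ℕ → ℕ, Tendsto m atTop atTop →
        Tendsto n atTop atTop → Tendsto (fun k => (m k : ℝ) / n k) atTop (𝓝 θ) →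
        Tendsto (fun k => D (m k) / D (n k)) atTop (𝓝 L) := by
      intro θ
      by_cases hθ : 0 < θ
      swap
      · exact ⟨0, fun h => absurd h hθ⟩
      have hcount := hVmono.countable_not_continuousAt
      have hcount' := hcount.preimage (f := fun ε => θ * ε) (mul_right_injective₀ hθ.ne')
      -- The limit volume is monotone in the level, so it has countably many discontinuities: some
      -- `ε` avoids them together with `θ * ε`. The bound `c / (1 + θ)` puts both levels below `c`.
      obtain ⟨ε, hεmem, hε0, hεlt⟩ := ((hcount.union hcount').dense_compl ℝ).exists_between
        (show (0 : ℝ) < c / (1 + θ) by positivity)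
      simp only [mem_compl_iff, mem_union, mem_preimage, mem_ofPred_eq, not_or, not_not] at hεmem
      have hεc : ε * (1 + θ) < c := (lt_div_iff₀ (by positivity)).1 hεlt
      refine ⟨μ.real (starSublevel χ r (θ * ε)) / μ.real (starSublevel χ r ε),
        fun _ m n hm hn hmn => ?_⟩
      have hmε : Tendsto (fun k => (m k / n k : ℝ) * ε) atTop (𝓝 (θ * ε)) := hmn.mul_const ε
      have l1 := tendsto_measureReal_starSublevel (μ := μ) hconv hεmem.2 hm hmε
      have l2 := tendsto_measureReal_starSublevel (μ := μ) hconv hεmem.1 hn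
        (tendsto_const_nhds (x := ε))
      refine (l1.div l2 (hVpos ε hε0).ne').congr' ?_
      filter_upwards [hm.eventually (eventually_ge_atTop N₂), hn.eventually (eventually_ge_atTop N₂),
        hmε.eventually (gt_mem_nhds (show θ * ε < c by nlinarith)),
        l2.eventually (lt_mem_nhds (hVpos ε hε0))] with k hk1 hk2 hk3 hk4
      simp only [Pi.div_apply]
      rw [key _ _ hk1 hk2 ε (by nlinarith) hk3, mul_div_cancel_right₀ _ hk4.ne']
    choose g hg using hlim
    exact ⟨g, fun θ hθ => hg θ hθ⟩

end Volume

/-! ### The rescaled functions, their limit and the sequence `a` -/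

lemma antitoneOn_div_id_of_concaveOn {F : ℝ → ℝ} (hF : ConcaveOn ℝ (Ici 0) F) (h0 : 0 ≤ F 0) :
    AntitoneOn (fun x => F x / x) (Ioi 0) := by
  intro x hx y hy hxy
  have hx : 0 < x := hx
  have hy : 0 < y := hy
  have := hF.2 (mem_Ici.2 hy.le) (mem_Ici.2 (le_refl (0 : ℝ)))
    (show 0 ≤ x / y by positivity) (sub_nonneg.2 ((div_le_one hy).2 hxy))
    (add_sub_cancel (x / y) 1)
  simp only [smul_eq_mul, mul_zero, add_zero, div_mul_cancel₀ _ hy.ne'] at this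
  have h2 : 0 ≤ (1 - x / y) * F 0 := mul_nonneg (sub_nonneg.2 ((div_le_one hy).2 hxy)) h0
  simp only
  rw [div_le_div_iff₀ hy hx]
  have h3 : x / y * F y ≤ F x := by linarith
  rw [div_mul_eq_mul_div, div_le_iff₀ hy] at h3
  linarith

/-- The rescaled function `y ↦ (aₙ D(aₙ) / n) F (n y / D(aₙ))`. -/
noncomputable def rescale (D : ℕ → ℝ) (F : ℝ → ℝ) (a : ℕ → ℕ) (n : ℕ) (y : ℝ) : ℝ :=
  ((a n : ℝ) * D (a n) / n) * F (n / D (a n) * y)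

section Rescale

variable {D : ℕ → ℝ} {F F' : ℝ → ℝ} {a : ℕ → ℕ}

lemma rescale_monotoneOn (hD : ∀ n, 0 < D n) (hF : MonotoneOn F (Ici 0)) (n : ℕ) :
    MonotoneOn (rescale D F a n) (Ioi 0) := by
  intro x hx y hy hxy
  have hx : 0 < x := hx
  have hy : 0 < y := hy
  have := hD (a n)
  exact mul_le_mul_of_nonneg_left (hF (mem_Ici.2 (by positivity)) (mem_Ici.2 (by positivity))
    (by gcongr)) (by positivity)

lemma rescale_div (hD : ∀ n, 0 < D n) {n : ℕ} (hn : 0 < n) (y : ℝ) :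
    rescale D F a n y / y = a n * (F (n / D (a n) * y) / (n / D (a n) * y)) := by
  have := hD (a n)
  have : (n : ℝ) ≠ 0 := by positivity
  rcases eq_or_ne y 0 with rfl | hy
  · simp
  · rw [rescale]
    field_simp

lemma rescale_div_antitoneOn (hD : ∀ n, 0 < D n) (hF : AntitoneOn (fun x => F x / x) (Ioi 0))
    {n : ℕ} (hn : 0 < n) : AntitoneOn (fun y => rescale D F a n y / y) (Ioi 0) := by
  intro x hx y hy hxy
  have hx : 0 < x := hx
  have hy : 0 < y := hy
  have := hD (a n)
  simp only [rescale_div hD hn]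
  exact mul_le_mul_of_nonneg_left (hF (mem_Ioi.2 (by positivity)) (mem_Ioi.2 (by positivity))
    (by gcongr)) (by positivity)

lemma limit_monotoneOn (hD : ∀ n, 0 < D n) (hF : MonotoneOn F (Ici 0))
    (hlim : ∀ y, 0 < y → Tendsto (fun n => rescale D F a n y) atTop (𝓝 (F' y))) :
    MonotoneOn F' (Ioi 0) := fun x hx y hy hxy =>
  le_of_tendsto_of_tendsto' (hlim x hx) (hlim y hy) fun n => rescale_monotoneOn hD hF n hx hy hxy

lemma limit_div_antitoneOn (hD : ∀ n, 0 < D n) (hF : AntitoneOn (fun x => F x / x) (Ioi 0))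
    (hlim : ∀ y, 0 < y → Tendsto (fun n => rescale D F a n y) atTop (𝓝 (F' y))) :
    AntitoneOn (fun y => F' y / y) (Ioi 0) := fun x hx y hy hxy =>
  le_of_tendsto_of_tendsto ((hlim y hy).div_const y) ((hlim x hx).div_const x) <| by
    filter_upwards [eventually_gt_atTop 0] with n hn
    exact rescale_div_antitoneOn hD hF hn hx hy hxy

lemma pos_of_monotoneOn_of_div_antitoneOn (hm : MonotoneOn F' (Ioi 0))
    (hQ : AntitoneOn (fun y => F' y / y) (Ioi 0)) {y₀ : ℝ} (hy₀ : 0 < y₀) (h : 0 < F' y₀)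
    {y : ℝ} (hy : 0 < y) : 0 < F' y := by
  rcases le_total y y₀ with hle | hle
  · have h1 : F' y₀ / y₀ ≤ F' y / y := hQ hy hy₀ hle
    have h2 : 0 < F' y / y := (div_pos h hy₀).trans_le h1
    exact (div_pos_iff_of_pos_right hy).1 h2
  · exact h.trans_le (hm hy₀ hy hle)

/-- Monotonicity traps the moving argument between fixed ones, and continuity of `F'` closes the
gap. -/
lemma tendsto_rescale_comp (hD : ∀ n, 0 < D n) (hF : MonotoneOn F (Ici 0))
    (hlim : ∀ y, 0 < y → Tendsto (fun n => rescale D F a n y) atTop (𝓝 (F' y)))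
    (hFc : ContinuousOn F' (Ioi 0)) {n : ℕ → ℕ} (hn : Tendsto n atTop atTop) {v : ℕ → ℝ} {y : ℝ}
    (hy : 0 < y) (hv : Tendsto v atTop (𝓝 y)) :
    Tendsto (fun k => rescale D F a (n k) (v k)) atTop (𝓝 (F' y)) := by
  have hcy : ContinuousAt F' y := hFc.continuousAt (Ioi_mem_nhds hy)
  refine tendsto_order.2 ⟨fun b hb => ?_, fun b hb => ?_⟩
  · have h1 : ∀ᶠ z in 𝓝[<] y, b < F' z :=
      (hcy.tendsto.mono_left nhdsWithin_le_nhds).eventually (lt_mem_nhds hb)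
    have h2 : ∀ᶠ z in 𝓝[<] y, 0 < z := nhdsWithin_le_nhds (lt_mem_nhds hy)
    obtain ⟨z, hz1, hz2, hz3⟩ := (h1.and (h2.and self_mem_nhdsWithin)).exists
    filter_upwards [((hlim z hz2).comp hn).eventually (lt_mem_nhds hz1),
      hv.eventually (lt_mem_nhds hz3)] with k hk1 hk2
    exact lt_of_lt_of_le hk1 (rescale_monotoneOn hD hF _ hz2 (hz2.trans hk2) hk2.le)
  · have h1 : ∀ᶠ z in 𝓝[>] y, F' z < b :=
      (hcy.tendsto.mono_left nhdsWithin_le_nhds).eventually (gt_mem_nhds hb)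
    obtain ⟨z, hz1, hz3⟩ := (h1.and self_mem_nhdsWithin).exists
    have hz3 : y < z := hz3
    filter_upwards [((hlim z (hy.trans hz3)).comp hn).eventually (gt_mem_nhds hz1),
      hv.eventually (gt_mem_nhds hz3), hv.eventually (lt_mem_nhds hy)] with k hk1 hk2 hk3
    exact lt_of_le_of_lt (rescale_monotoneOn hD hF _ hk3 (hk3.trans hk2) hk2.le) hk1

/-- Cluster points `ρ` of `a (m k) / a (n k)` satisfy a functional equation. -/
lemma limit_functional_equation (hD : ∀ n, 0 < D n) {δ : ℝ}
    (hreg : RegVar D (fun x => x ^ δ)) (hF : MonotoneOn F (Ici 0))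
    (hlim : ∀ y, 0 < y → Tendsto (fun n => rescale D F a n y) atTop (𝓝 (F' y)))
    (hFc : ContinuousOn F' (Ioi 0)) (ha : Tendsto a atTop atTop)
    {m n : ℕ → ℕ} (hm : Tendsto m atTop atTop) (hn : Tendsto n atTop atTop)
    {l ρ : ℝ} (hl : 0 < l) (hρ : 0 < ρ) (hmn : Tendsto (fun k => (m k : ℝ) / n k) atTop (𝓝 l))
    (haρ : Tendsto (fun k => (a (m k) : ℝ) / a (n k)) atTop (𝓝 ρ)) {y : ℝ} (hy : 0 < y) :
    F' (l / ρ ^ δ * y) * (ρ / (l / ρ ^ δ)) = F' y := by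
  have hρδ : 0 < ρ ^ δ := Real.rpow_pos_of_pos hρ δ
  have hDr := hreg ρ hρ _ _ (ha.comp hm) (ha.comp hn) haρ
  have hu := hmn.div hDr hρδ.ne'
  have hu0 : 0 < l / ρ ^ δ := by positivity
  -- The moving argument is chosen so that `F` gets evaluated at `m k / D (a (m k)) * y`; the
  -- rescalings at `m k` and `n k` then differ only by their prefactors.
  have h1 := tendsto_rescale_comp hD hF hlim hFc hn (mul_pos hu0 hy) (hu.mul_const y)
  have h2 := h1.mul (haρ.div hu hu0.ne')
  refine tendsto_nhds_unique h2 (((hlim y hy).comp hm).congr' ?_)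
  filter_upwards [hm.eventually_gt_atTop 0, hn.eventually_gt_atTop 0,
    (ha.comp hm).eventually_gt_atTop 0, (ha.comp hn).eventually_gt_atTop 0] with k k1 k2 k3 k4
  simp only [Function.comp_apply] at k3 k4
  have d1 := hD (a (m k))
  have d2 := hD (a (n k))
  have : (m k : ℝ) ≠ 0 := by positivity
  have : (n k : ℝ) ≠ 0 := by positivity
  have : (a (m k) : ℝ) ≠ 0 := by positivity
  have : (a (n k) : ℝ) ≠ 0 := by positivity
  simp only [Function.comp_apply, rescale, Pi.div_apply]
  have e : (n k : ℝ) / D (a (n k)) * ((m k : ℝ) / n k / (D (a (m k)) / D (a (n k))) * y) =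
      m k / D (a (m k)) * y := by field_simp
  rw [e]
  field_simp

/-- This gives compactness for the ratios `a (m k) / a (n k)`; exchanging `m` and `n` bounds them
below. -/
lemma eventually_le_mul (hD : ∀ n, 0 < D n) {C : ℝ} (hC : 0 < C)
    (hmono : ∀ᶠ m in atTop, ∀ n, m ≤ n → D m ≤ C * D n)
    (hQ : AntitoneOn (fun x => F x / x) (Ioi 0))
    (hlim : ∀ y, 0 < y → Tendsto (fun n => rescale D F a n y) atTop (𝓝 (F' y)))
    (hpos : ∀ y, 0 < y → 0 < F' y) (ha : Tendsto a atTop atTop)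
    {m n : ℕ → ℕ} (hm : Tendsto m atTop atTop) (hn : Tendsto n atTop atTop)
    {l : ℝ} (hl : 0 < l) (hmn : Tendsto (fun k => (m k : ℝ) / n k) atTop (𝓝 l)) :
    ∃ M > 0, ∀ᶠ k in atTop, (a (m k) : ℝ) ≤ M * a (n k) := by
  -- If `a (n k) ≤ a (m k)`, this `U` makes `m k / D (a (m k))` at most `U * n k / D (a (n k))`, so
  -- the antitone `F x / x` can be compared there. Below, `q` is half of `F' U / U`.
  set U := (l + 1) * C with hU
  have hU0 : 0 < U := by positivity
  set q := F' U / (2 * U) with hq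
  have hFU := hpos U hU0
  have hF1 := hpos 1 one_pos
  have hq0 : 0 < q := by positivity
  refine ⟨max 1 (2 * F' 1 / q), by positivity, ?_⟩
  filter_upwards [hm.eventually_gt_atTop 0, hn.eventually_gt_atTop 0,
    (ha.comp hn).eventually hmono, (ha.comp hn).eventually_gt_atTop 0,
    hmn.eventually (gt_mem_nhds (lt_add_one l)),
    ((hlim U hU0).comp hn).eventually (lt_mem_nhds (half_lt_self hFU)),
    ((hlim 1 one_pos).comp hm).eventually (gt_mem_nhds (show F' 1 < 2 * F' 1 by linarith))]
    with k k1 k2 k3 k4 k5 k6 k7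
  simp only [Function.comp_apply] at k3 k4 k6 k7
  have hn0 : (0 : ℝ) < n k := by positivity
  have hm0 : (0 : ℝ) < m k := by positivity
  have han0 : (0 : ℝ) < a (n k) := by positivity
  rcases le_total (a (m k)) (a (n k)) with hle | hle
  · have : (a (m k) : ℝ) ≤ a (n k) := by exact_mod_cast hle
    calc (a (m k) : ℝ) ≤ 1 * a (n k) := by linarith
      _ ≤ _ := mul_le_mul_of_nonneg_right (le_max_left _ _) han0.le
  · have d1 := hD (a (m k))
    have d2 := hD (a (n k))
    have hDle := k3 _ hle
    have hmle : (m k : ℝ) < (l + 1) * n k := (div_lt_iff₀ hn0).1 k5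
    have hx : (m k : ℝ) / D (a (m k)) * 1 ≤ n k / D (a (n k)) * U := by
      rw [mul_one, div_mul_eq_mul_div, div_le_div_iff₀ d1 d2]
      calc (m k : ℝ) * D (a (n k)) ≤ ((l + 1) * n k) * (C * D (a (m k))) := by gcongr
        _ = _ := by rw [hU]; ring
    have hQx := hQ (mem_Ioi.2 (by positivity)) (mem_Ioi.2 (by positivity)) hx
    simp only at hQx
    have e1 := rescale_div (F := F) (a := a) hD k1 1
    have e2 := rescale_div (F := F) (a := a) hD k2 U
    have e3 : q < rescale D F a (n k) U / U := by
      rw [hq, lt_div_iff₀ hU0]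
      calc F' U / (2 * U) * U = F' U / 2 := by field_simp
        _ < _ := k6
    rw [div_one] at e1
    set Qm := F (m k / D (a (m k)) * 1) / (m k / D (a (m k)) * 1)
    set Qn := F (n k / D (a (n k)) * U) / (n k / D (a (n k)) * U)
    rw [e2] at e3
    rw [e1] at k7
    have h3 : (a (m k) : ℝ) * q ≤ 2 * F' 1 * a (n k) := by
      calc (a (m k) : ℝ) * q ≤ a (m k) * (a (n k) * Qn) := by gcongr
        _ = a (n k) * (a (m k) * Qn) := by ring
        _ ≤ a (n k) * (a (m k) * Qm) := by gcongr
        _ ≤ a (n k) * (2 * F' 1) := by gcongr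
        _ = _ := by ring
    rw [← le_div_iff₀ hq0] at h3
    calc (a (m k) : ℝ) ≤ 2 * F' 1 / q * a (n k) := by
          rw [div_mul_eq_mul_div]; exact h3
      _ ≤ _ := mul_le_mul_of_nonneg_right (le_max_right _ _) han0.le

/-- Every subsequence of ratios has a cluster point, and the functional equation has one solution
only: its left side is strictly increasing in `ρ`. -/
theorem exists_regVar_seq (hD : ∀ n, 0 < D n) {δ : ℝ} (hδ : 0 ≤ δ)
    (hreg : RegVar D (fun x => x ^ δ)) {C : ℝ} (hC : 0 < C)
    (hmono : ∀ᶠ m in atTop, ∀ n, m ≤ n → D m ≤ C * D n)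
    (hF : MonotoneOn F (Ici 0)) (hQ : AntitoneOn (fun x => F x / x) (Ioi 0))
    (hlim : ∀ y, 0 < y → Tendsto (fun n => rescale D F a n y) atTop (𝓝 (F' y)))
    (hFc : ContinuousOn F' (Ioi 0)) (hpos : ∀ y, 0 < y → 0 < F' y)
    (ha : Tendsto a atTop atTop) : ∃ g, RegVar (fun n => (a n : ℝ)) g := by
  have hQ' := limit_div_antitoneOn hD hQ hlim
  have hcluster : ∀ l : ℝ, 0 < l → ∀ m n : ℕ → ℕ, Tendsto m atTop atTop →
      Tendsto n atTop atTop → Tendsto (fun k => (m k : ℝ) / n k) atTop (𝓝 l) →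
      ∃ φ : ℕ → ℕ, StrictMono φ ∧ ∃ ρ > 0, F' (l / ρ ^ δ) * (ρ / (l / ρ ^ δ)) = F' 1 ∧
        Tendsto (fun k => (a (m (φ k)) : ℝ) / a (n (φ k))) atTop (𝓝 ρ) := by
    intro l hl m n hm hn hmn
    have hnm : Tendsto (fun k => (n k : ℝ) / m k) atTop (𝓝 l⁻¹) := by
      refine (hmn.inv₀ hl.ne').congr fun k => ?_
      rw [inv_div]
    obtain ⟨M, hM0, hM⟩ := eventually_le_mul hD hC hmono hQ hlim hpos ha hm hn hl hmn
    obtain ⟨M', hM'0, hM'⟩ := eventually_le_mul hD hC hmono hQ hlim hpos ha hn hm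
      (inv_pos.2 hl) hnm
    have hIcc : ∀ᶠ k in atTop, (a (m k) : ℝ) / a (n k) ∈ Icc M'⁻¹ M := by
      filter_upwards [hM, hM', (ha.comp hn).eventually_gt_atTop 0] with k k1 k2 k3
      have k3 : (0 : ℝ) < a (n k) := Nat.cast_pos.2 k3
      refine ⟨?_, (div_le_iff₀ k3).2 k1⟩
      rw [inv_eq_one_div, div_le_div_iff₀ hM'0 k3]
      linarith
    obtain ⟨ρ, hρmem, φ, hφ, hρ⟩ := isCompact_Icc.tendsto_subseq' hIcc.frequently
    have hρ0 : 0 < ρ := (inv_pos.2 hM'0).trans_le hρmem.1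
    refine ⟨φ, hφ, ρ, hρ0, ?_, hρ⟩
    have := limit_functional_equation hD hreg hF hlim hFc ha (hm.comp hφ.tendsto_atTop)
      (hn.comp hφ.tendsto_atTop) hl hρ0 (hmn.comp hφ.tendsto_atTop) hρ one_pos
    rwa [mul_one] at this
  have hlt : ∀ l : ℝ, 0 < l → ∀ ρ ρ' : ℝ, 0 < ρ → ρ < ρ' →
      F' (l / ρ ^ δ) * (ρ / (l / ρ ^ δ)) < F' (l / ρ' ^ δ) * (ρ' / (l / ρ' ^ δ)) := by
    intro l hl ρ ρ' hρ hρρ'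
    have hρ' := hρ.trans hρρ'
    have p1 : 0 < l / ρ ^ δ := div_pos hl (Real.rpow_pos_of_pos hρ δ)
    have p2 : 0 < l / ρ' ^ δ := div_pos hl (Real.rpow_pos_of_pos hρ' δ)
    have hle : l / ρ' ^ δ ≤ l / ρ ^ δ := by
      have := Real.rpow_le_rpow hρ.le hρρ'.le hδ
      have := Real.rpow_pos_of_pos hρ δ
      gcongr
    have h1 : F' (l / ρ ^ δ) / (l / ρ ^ δ) ≤ F' (l / ρ' ^ δ) / (l / ρ' ^ δ) := hQ' p2 p1 hle
    have h2 : 0 < F' (l / ρ ^ δ) / (l / ρ ^ δ) := div_pos (hpos _ p1) p1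
    rw [mul_div_left_comm, mul_div_left_comm (F' (l / ρ' ^ δ))]
    exact mul_lt_mul hρρ' h1 h2 hρ'.le
  have huniq : ∀ l : ℝ, 0 < l → ∀ ρ ρ' : ℝ, 0 < ρ → 0 < ρ' →
      F' (l / ρ ^ δ) * (ρ / (l / ρ ^ δ)) = F' 1 → F' (l / ρ' ^ δ) * (ρ' / (l / ρ' ^ δ)) = F' 1 →
      ρ = ρ' := by
    intro l hl ρ ρ' hρ hρ' h h'
    rcases lt_trichotomy ρ ρ' with hlt' | heq | hlt'
    · exact absurd (h.trans h'.symm) (hlt l hl ρ ρ' hρ hlt').ne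
    · exact heq
    · exact absurd (h'.trans h.symm) (hlt l hl ρ' ρ hρ' hlt').ne
  have hex : ∀ l : ℝ, ∃ ρ : ℝ, 0 < l → 0 < ρ ∧ F' (l / ρ ^ δ) * (ρ / (l / ρ ^ δ)) = F' 1 := by
    intro l
    by_cases hl : 0 < l
    · obtain ⟨-, -, ρ, hρ, h, -⟩ := hcluster l hl _ _ (tendsto_floor_mul hl) tendsto_id
        (tendsto_floor_mul_div hl)
      exact ⟨ρ, fun _ => ⟨hρ, h⟩⟩
    · exact ⟨0, fun h => absurd h hl⟩
  choose g hg using hex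
  refine ⟨g, fun l hl m n hm hn hmn => tendsto_of_subseq_tendsto fun ns hns => ?_⟩
  obtain ⟨φ, -, ρ, hρ, h, ht⟩ := hcluster l hl _ _ (hm.comp hns) (hn.comp hns) (hmn.comp hns)
  refine ⟨φ, ?_⟩
  rw [huniq l hl (g l) ρ (hg l hl).1 hρ (hg l hl).2 h]
  exact ht

theorem exists_power_of_unbounded (hD : ∀ n, 0 < D n) {δ : ℝ} (hδ : 0 ≤ δ)
    (hreg : RegVar D (fun x => x ^ δ)) {C : ℝ} (hC : 0 < C)
    (hmono : ∀ᶠ m in atTop, ∀ n, m ≤ n → D m ≤ C * D n)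
    (hF : MonotoneOn F (Ici 0)) (hQ : AntitoneOn (fun x => F x / x) (Ioi 0))
    (hlim : ∀ y, 0 < y → Tendsto (fun n => rescale D F a n y) atTop (𝓝 (F' y)))
    (hFc : ContinuousOn F' (Ioi 0)) (hpos : ∀ y, 0 < y → 0 < F' y)
    (ham : Monotone a) (ha : Tendsto a atTop atTop) :
    ∃ γ : ℝ, 0 ≤ γ ∧ γ ≤ 1 ∧ (∀ y : ℝ, 0 < y → F' y = F' 1 * y ^ γ) ∧
      ∃ κ : ℝ, 0 ≤ κ ∧ (γ < 1 → 0 < κ) ∧ RegVar (fun n => (a n : ℝ)) (fun x => x ^ κ) := by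
  obtain ⟨g, hg⟩ := exists_regVar_seq hD hδ hreg hC hmono hF hQ hlim hFc hpos ha
  obtain ⟨κ, hκ, haκ⟩ := hg.exists_rpow (C := 1)
    ((ha.eventually_gt_atTop 0).mono fun n hn => Nat.cast_pos.2 hn) one_pos
    (Eventually.of_forall fun m n hmn => by rw [one_mul]; exact_mod_cast ham hmn)
  have heq : ∀ l : ℝ, 0 < l → F' (l ^ (1 - δ * κ)) * (l ^ κ / l ^ (1 - δ * κ)) = F' 1 := by
    intro l hl
    have h := limit_functional_equation hD hreg hF hlim hFc ha (tendsto_floor_mul hl) tendsto_id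
      hl (Real.rpow_pos_of_pos hl κ) (tendsto_floor_mul_div hl)
      (haκ l hl _ _ (tendsto_floor_mul hl) tendsto_id (tendsto_floor_mul_div hl)) one_pos
    have e : l / (l ^ κ) ^ δ = l ^ (1 - δ * κ) := by
      rw [Real.rpow_sub hl, Real.rpow_one, ← Real.rpow_mul hl.le, mul_comm κ δ]
    rwa [mul_one, e] at h
  have hF1 := hpos 1 one_pos
  -- Otherwise the equation at `l = 2` reads `2 ^ κ = 1`, so `κ = 0`, against `δ * κ = 1`.
  have hne : 1 - δ * κ ≠ 0 := by
    intro h0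
    have h2 := heq 2 two_pos
    rw [h0, Real.rpow_zero, div_one] at h2
    have h3 : (2 : ℝ) ^ κ = 1 := mul_left_cancel₀ hF1.ne' (h2.trans (mul_one _).symm)
    have hκ0 : 0 < κ := by
      rcases hκ.eq_or_lt with h | h
      · rw [← h] at h0; norm_num at h0
      · exact h
    exact absurd h3 (Real.one_lt_rpow one_lt_two hκ0).ne'
  set e := 1 - δ * κ with he
  have hpow : ∀ y : ℝ, 0 < y → F' y = F' 1 * y ^ (1 - κ / e) := by
    intro y hy
    have h := heq (y ^ e⁻¹) (Real.rpow_pos_of_pos hy _)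
    rw [← Real.rpow_mul hy.le, ← Real.rpow_mul hy.le, inv_mul_cancel₀ hne, Real.rpow_one,
      inv_mul_eq_div] at h
    rw [Real.rpow_sub hy, Real.rpow_one, ← h]
    have := Real.rpow_pos_of_pos hy (κ / e)
    field_simp
  have hM' := limit_monotoneOn hD hF hlim
  have hQ' := limit_div_antitoneOn hD hQ hlim
  -- Comparing the values at `1` and `2` is enough to place the exponent in `[0, 1]`.
  have h12 : F' 1 ≤ F' 2 := hM' (mem_Ioi.2 one_pos) (mem_Ioi.2 two_pos) one_le_two
  have h21 : F' 2 / 2 ≤ F' 1 / 1 := hQ' (mem_Ioi.2 one_pos) (mem_Ioi.2 two_pos) one_le_two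
  rw [hpow 2 two_pos] at h12 h21
  refine ⟨1 - κ / e, ?_, ?_, hpow, κ, hκ, fun h => ?_, haκ⟩
  · by_contra! hlt
    have := Real.rpow_lt_one_of_one_lt_of_neg one_lt_two hlt
    nlinarith
  · by_contra! hlt
    have := Real.rpow_lt_rpow_of_exponent_lt one_lt_two hlt
    rw [Real.rpow_one] at this
    nlinarith
  · rcases hκ.eq_or_lt with h0 | h0
    · rw [← h0] at h; simp at h
    · exact h0

lemma limit_linear_of_eventually_const (hD : ∀ n, 0 < D n) (hFn : ∀ x, 0 ≤ x → 0 ≤ F x)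
    (hQ : AntitoneOn (fun x => F x / x) (Ioi 0))
    (hlim : ∀ y, 0 < y → Tendsto (fun n => rescale D F a n y) atTop (𝓝 (F' y)))
    {A : ℕ} (hA : ∀ᶠ n in atTop, a n = A) {y : ℝ} (hy : 0 < y) : F' y = F' 1 * y := by
  obtain ⟨L, hL⟩ : ∃ L, Tendsto (fun x => F x / x) atTop (𝓝 L) := by
    have hanti : Antitone fun x => F (max x 1) / max x 1 := fun x z hxz =>
      hQ (mem_Ioi.2 (by positivity)) (mem_Ioi.2 (by positivity)) (max_le_max_right 1 hxz)
    refine ⟨_, (tendsto_atTop_ciInf hanti ⟨0, ?_⟩).congr' ?_⟩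
    · rintro _ ⟨x, rfl⟩
      have : 0 ≤ max x 1 := by positivity
      exact div_nonneg (hFn _ this) this
    · filter_upwards [eventually_ge_atTop 1] with x hx
      rw [max_eq_left hx]
  have key : ∀ z : ℝ, 0 < z → F' z / z = A * L := by
    intro z hz
    have hx : Tendsto (fun n : ℕ => (n : ℝ) / D A * z) atTop atTop :=
      (tendsto_natCast_atTop_atTop.atTop_div_const (hD A)).atTop_mul_const hz
    refine tendsto_nhds_unique ((hlim z hz).div_const z) (((hL.comp hx).const_mul (A : ℝ)).congr' ?_)
    filter_upwards [hA, eventually_gt_atTop 0] with n hn hn0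
    rw [rescale_div hD hn0, hn]
    rfl
  have h1 := key y hy
  rw [← key 1 one_pos, div_one, div_eq_iff hy.ne'] at h1
  exact h1

end Rescale

/-! ### Characteristic functions under weak convergence -/

section CharFun

variable {E : Type*} [NormedAddCommGroup E] [InnerProductSpace ℝ E] [MeasurableSpace E]
  [BorelSpace E] [SecondCountableTopology E]

open scoped RealInnerProductSpace

/-- The truncated modulus of continuity of the characters `x ↦ exp (i ⟪x, t⟫)`. -/
noncomputable def charModulus (E : Type*) [NormedAddCommGroup E] (δ : ℝ) :
    BoundedContinuousFunction E ℝ :=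
  BoundedContinuousFunction.ofNormedAddCommGroup (fun x => min 2 (‖x‖ * |δ|)) (by fun_prop) 2
    fun x => by
      rw [Real.norm_of_nonneg (by positivity)]
      exact min_le_left _ _

lemma norm_exp_inner_sub_le {δ : ℝ} {s t : E} (h : ‖s - t‖ ≤ δ) (x : E) :
    ‖Complex.exp (⟪x, s⟫ * Complex.I) - Complex.exp (⟪x, t⟫ * Complex.I)‖ ≤ charModulus E δ x := by
  have hδ : 0 ≤ δ := (norm_nonneg _).trans h
  refine le_min ?_ ?_
  · refine (norm_sub_le _ _).trans ?_
    rw [Complex.norm_exp_ofReal_mul_I, Complex.norm_exp_ofReal_mul_I]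
    norm_num
  · have e : Complex.exp (⟪x, s⟫ * Complex.I) - Complex.exp (⟪x, t⟫ * Complex.I) =
        Complex.exp (⟪x, t⟫ * Complex.I) *
          (Complex.exp (Complex.I * ((⟪x, s - t⟫ : ℝ) : ℂ)) - 1) := by
      rw [mul_sub, ← Complex.exp_add, inner_sub_right, mul_one]
      congr 2
      push_cast
      ring
    rw [e, norm_mul, Complex.norm_exp_ofReal_mul_I, one_mul, abs_of_nonneg hδ]
    refine Real.norm_exp_I_mul_ofReal_sub_one_le.trans ?_
    refine (norm_inner_le_norm x (s - t)).trans ?_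
    gcongr

lemma norm_charFun_sub_le (ν : ProbabilityMeasure E) {δ : ℝ} {s t : E} (h : ‖s - t‖ ≤ δ) :
    ‖charFun (ν : Measure E) s - charFun (ν : Measure E) t‖ ≤ ∫ x, charModulus E δ x ∂ν := by
  have hint : ∀ u : E, Integrable (fun x : E => Complex.exp (⟪x, u⟫ * Complex.I))
      (ν : Measure E) := fun u =>
    (integrable_const (1 : ℝ)).mono (by fun_prop) (by simp [Complex.norm_exp_ofReal_mul_I])
  rw [charFun_apply, charFun_apply, ← integral_sub (hint s) (hint t)]
  exact norm_integral_le_of_norm_le ((charModulus E δ).integrable _)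
    (Eventually.of_forall (norm_exp_inner_sub_le h))

lemma exists_integral_charModulus_lt (ν : ProbabilityMeasure E) {η : ℝ} (hη : 0 < η) :
    ∃ δ > 0, ∫ x, charModulus E δ x ∂ν < η := by
  have h : Tendsto (fun k : ℕ => ∫ x, charModulus E (1 / ((k : ℝ) + 1)) x ∂ν) atTop
      (𝓝 (∫ _, (0 : ℝ) ∂(ν : Measure E))) := by
    refine tendsto_integral_of_dominated_convergence (fun _ => 2)
      (fun k => (charModulus E _).continuous.aestronglyMeasurable) (integrable_const _)
      (fun k => Eventually.of_forall fun x => ?_) (Eventually.of_forall fun x => ?_)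
    · change ‖min 2 (‖x‖ * |_|)‖ ≤ 2
      rw [Real.norm_of_nonneg (by positivity)]
      exact min_le_left _ _
    · change Tendsto (fun k : ℕ => min 2 (‖x‖ * |1 / ((k : ℝ) + 1)|)) atTop (𝓝 0)
      have h1 := ((tendsto_one_div_add_atTop_nhds_zero_nat (𝕜 := ℝ)).abs.const_mul ‖x‖)
      have h2 := (tendsto_const_nhds (x := (2 : ℝ))).min h1
      simpa using h2
  rw [integral_zero] at h
  obtain ⟨k, hk⟩ := (h.eventually (gt_mem_nhds hη)).exists
  exact ⟨_, Nat.one_div_pos_of_nat, hk⟩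

/-- Weak convergence implies uniform convergence of characteristic functions on compact sets. -/
lemma tendstoUniformlyOn_charFun {ν : ℕ → ProbabilityMeasure E} {ν₀ : ProbabilityMeasure E}
    (h : Tendsto ν atTop (𝓝 ν₀)) {K : Set E} (hK : IsCompact K)
    (hpt : ∀ t, Tendsto (fun n => charFun (ν n : Measure E) t) atTop
      (𝓝 (charFun (ν₀ : Measure E) t))) :
    TendstoUniformlyOn (fun n => charFun (ν n : Measure E)) (charFun (ν₀ : Measure E)) atTop K := by
  rw [← tendstoLocallyUniformlyOn_iff_tendstoUniformlyOn_of_compact hK,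
    Metric.tendstoLocallyUniformlyOn_iff]
  intro ε hε t _
  obtain ⟨δ, hδ, hlt⟩ := exists_integral_charModulus_lt ν₀ (show 0 < ε / 3 by positivity)
  -- The modulus is bounded and continuous, so its integral is small for `ν n` as well: this is
  -- equicontinuity at `t`.
  have hev := (ProbabilityMeasure.tendsto_iff_forall_integral_tendsto.1 h
    (charModulus E δ)).eventually (gt_mem_nhds hlt)
  refine ⟨Metric.ball t δ, mem_nhdsWithin_of_mem_nhds (Metric.ball_mem_nhds t hδ), ?_⟩
  filter_upwards [hev, (Metric.tendsto_nhds.1 (hpt t)) (ε / 3) (by positivity)] with n h1 h2 s hs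
  have hst : ‖s - t‖ ≤ δ := by
    rw [← dist_eq_norm]
    exact (Metric.mem_ball.1 hs).le
  have h3 := norm_charFun_sub_le ν₀ hst
  have h4 := norm_charFun_sub_le (ν n) hst
  rw [← dist_eq_norm] at h3 h4
  have h5 := dist_triangle4 (charFun (ν₀ : Measure E) s) (charFun (ν₀ : Measure E) t)
    (charFun (ν n : Measure E) t) (charFun (ν n : Measure E) s)
  rw [dist_comm (charFun (ν₀ : Measure E) t),
    dist_comm (charFun (ν n : Measure E) t) (charFun (ν n : Measure E) s)] at h5
  linarith

lemma ae_cos_inner_eq_one (ν : ProbabilityMeasure E) {t : E}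
    (h : charFun (ν : Measure E) t = 1) :
    ∀ᵐ x ∂(ν : Measure E), Real.cos ⟪x, t⟫ = 1 := by
  have hint : Integrable (fun x : E => Complex.exp (⟪x, t⟫ * Complex.I)) (ν : Measure E) :=
    (integrable_const (1 : ℝ)).mono (by fun_prop) (by simp [Complex.norm_exp_ofReal_mul_I])
  have hint' : Integrable (fun x : E => Real.cos ⟪x, t⟫) (ν : Measure E) :=
    (integrable_const (1 : ℝ)).mono (by fun_prop)
      (Eventually.of_forall fun x => by simpa using Real.abs_cos_le_one _)
  have hre : ∫ x, Real.cos ⟪x, t⟫ ∂(ν : Measure E) = 1 := by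
    have := congrArg Complex.re h
    rw [charFun_apply, Complex.one_re] at this
    rw [← this]
    refine Eq.trans ?_ (integral_re hint)
    simp [Complex.exp_ofReal_mul_I_re]
  have hzero : ∫ x, (1 - Real.cos ⟪x, t⟫) ∂(ν : Measure E) = 0 := by
    rw [integral_sub (integrable_const _) hint', hre]
    simp
  rw [integral_eq_zero_iff_of_nonneg (fun x => sub_nonneg.2 (Real.cos_le_one _))
    ((integrable_const _).sub hint')] at hzero
  filter_upwards [hzero] with x hx
  have : 1 - Real.cos ⟪x, t⟫ = 0 := hx
  linarith

lemma measure_ker_inner_eq_one (ν : ProbabilityMeasure E) {t : E}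
    (h : ∀ s ∈ Icc (0 : ℝ) 1, charFun (ν : Measure E) (s • t) = 1) :
    (ν : Measure E) ((ℝ ∙ t)ᗮ : Submodule ℝ E) = 1 := by
  have hae : ∀ᵐ x ∂(ν : Measure E), ∀ k : ℕ, Real.cos ⟪x, (1 / ((k : ℝ) + 1)) • t⟫ = 1 :=
    ae_all_iff.2 fun k => ae_cos_inner_eq_one ν (h _ ⟨by positivity, by
      rw [div_le_one (by positivity)]
      linarith [Nat.cast_nonneg (α := ℝ) k]⟩)
  have hmem : ∀ᵐ x ∂(ν : Measure E), x ∈ (((ℝ ∙ t)ᗮ : Submodule ℝ E) : Set E) := by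
    filter_upwards [hae] with x hx
    rw [SetLike.mem_coe, Submodule.mem_orthogonal_singleton_iff_inner_left]
    -- Dividing by `k + 1` brings the inner product into `(-2π, 2π)`, where `cos = 1` only at `0`.
    obtain ⟨k, hk⟩ := exists_nat_gt |⟪x, t⟫|
    have hk0 : (0 : ℝ) < (k : ℝ) + 1 := by positivity
    have hpi := Real.pi_gt_three
    have hlt : |1 / ((k : ℝ) + 1) * ⟪x, t⟫| < 2 * Real.pi := by
      rw [abs_mul, abs_of_pos (by positivity : 0 < 1 / ((k : ℝ) + 1)), one_div_mul_eq_div,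
        div_lt_iff₀ hk0]
      nlinarith
    have hcos := hx k
    rw [inner_smul_right] at hcos
    have h0 := (Real.cos_eq_one_iff_of_lt_of_lt (abs_lt.1 hlt).1 (abs_lt.1 hlt).2).1 hcos
    exact (mul_eq_zero.1 h0).resolve_left (by positivity)
  rw [measure_eq_measure_of_null_sdiff (subset_univ _) ?_, measure_univ]
  rw [← compl_eq_univ_sdiff]
  exact hmem

end CharFun

/-! ### Application to the random walk -/

open scoped RealInnerProductSpace

/-- The inclusion of `ℤ^d` into `ℝ^d`. -/
noncomputable def intEmbedding (d : ℕ) : (Fin d → ℤ) →+ EuclideanSpace ℝ (Fin d) where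
  toFun x := WithLp.toLp 2 fun i => (x i : ℝ)
  map_zero' := by ext; simp
  map_add' x y := by ext; simp

lemma charFun_map_convPow {d : ℕ} (μ : ProbabilityMeasure (Fin d → ℤ)) (n : ℕ)
    (t : EuclideanSpace ℝ (Fin d)) :
    charFun ((convPow μ n : Measure (Fin d → ℤ)).map (intEmbedding d)) t =
      charFun ((μ : Measure (Fin d → ℤ)).map (intEmbedding d)) t ^ n := by
  have hmeas : Measurable (intEmbedding d) := measurable_of_countable _
  induction n with
  | zero =>
    change charFun ((Measure.dirac 0).map (intEmbedding d)) t = _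
    rw [Measure.map_dirac' hmeas, map_zero, charFun_dirac]
    simp
  | succ n ih =>
    change charFun (((convPow μ n : Measure (Fin d → ℤ)).conv (μ : Measure (Fin d → ℤ))).map
      (intEmbedding d)) t = _
    have := Measure.isProbabilityMeasure_map (μ := (convPow μ n : Measure (Fin d → ℤ)))
      hmeas.aemeasurable
    have := Measure.isProbabilityMeasure_map (μ := (μ : Measure (Fin d → ℤ))) hmeas.aemeasurable
    rw [Measure.map_conv_addMonoidHom _ hmeas, charFun_conv, ih, pow_succ]

/-- The real inverse of an integer matrix. -/
noncomputable def realInv {d : ℕ} (B : Matrix (Fin d) (Fin d) ℤ) : Matrix (Fin d) (Fin d) ℝ :=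
  (B.map (fun k : ℤ => (k : ℝ)))⁻¹

lemma det_realInv {d : ℕ} (B : Matrix (Fin d) (Fin d) ℤ) :
    (realInv B).det = ((B.det : ℤ) : ℝ)⁻¹ := by
  rw [realInv, Matrix.det_nonsing_inv, Ring.inverse_eq_inv']
  congr 1
  exact (Int.cast_det B).symm

lemma charFun_invMap {d : ℕ} (B : Matrix (Fin d) (Fin d) ℤ) (ν : ProbabilityMeasure (Fin d → ℤ))
    (t : EuclideanSpace ℝ (Fin d)) :
    charFun (invMap B ν : Measure (EuclideanSpace ℝ (Fin d))) t =
      charFun ((ν : Measure (Fin d → ℤ)).map (intEmbedding d))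
        ((realInv B).conjTranspose.toEuclideanLin t) := by
  have h1 : (invMap B ν : Measure (EuclideanSpace ℝ (Fin d))) =
      (ν : Measure (Fin d → ℤ)).map (invApply B) := rfl
  rw [h1, charFun_apply, charFun_apply,
    integral_map (measurable_of_countable _).aemeasurable (by fun_prop),
    integral_map (measurable_of_countable _).aemeasurable (by fun_prop)]
  refine integral_congr_ae (Eventually.of_forall fun x => ?_)
  simp only [Matrix.toEuclideanLin_conjTranspose_eq_adjoint, LinearMap.adjoint_inner_right]
  rfl

lemma absDet_pos {d : ℕ} {B : Matrix (Fin d) (Fin d) ℤ} (h : B.det ≠ 0) : 0 < absDet B :=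
  abs_pos.2 (Int.cast_ne_zero.2 h)

theorem exists_regVar_absDet {d : ℕ} {μ : ProbabilityMeasure (Fin d → ℤ)}
    {B : ℕ → Matrix (Fin d) (Fin d) ℤ} {η : ProbabilityMeasure (EuclideanSpace ℝ (Fin d))}
    (hη : Adapted η) (hC : ConvergenceAssumption μ B η) :
    (∃ C > 0, ∀ᶠ m in atTop, ∀ n, m ≤ n → absDet (B m) ≤ C * absDet (B n)) ∧
      ∃ g, RegVar (fun n => absDet (B n)) g := by
  have hD : ∀ n, 0 < absDet (B n) := fun n => absDet_pos (hC.det_ne_zero n)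
  set P := (μ : Measure (Fin d → ℤ)).map (intEmbedding d) with hP
  have hPp : IsProbabilityMeasure P := Measure.isProbabilityMeasure_map
    (measurable_of_countable _).aemeasurable
  have hdet : ∀ n, LinearMap.det ((realInv (B n)).conjTranspose.toEuclideanLin) =
      (((B n).det : ℤ) : ℝ)⁻¹ := fun n => by
    rw [LinearMap.det_toLpLin, Matrix.det_conjTranspose, det_realInv]
    simp
  have hdet0 : ∀ n, LinearMap.det ((realInv (B n)).conjTranspose.toEuclideanLin) ≠ 0 := fun n => by
    rw [hdet]
    exact inv_ne_zero (Int.cast_ne_zero.2 (hC.det_ne_zero n))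
  let T : ℕ → EuclideanSpace ℝ (Fin d) ≃ₗ[ℝ] EuclideanSpace ℝ (Fin d) := fun n =>
    LinearMap.equivOfDetNeZero _ (hdet0 n)
  have hTapply : ∀ n x, T n x = (realInv (B n)).conjTranspose.toEuclideanLin x := fun n x => rfl
  have hTD : ∀ n, |LinearMap.det (T n : EuclideanSpace ℝ (Fin d) →ₗ[ℝ] EuclideanSpace ℝ (Fin d))| =
      (absDet (B n))⁻¹ := fun n => by
    have : (T n : EuclideanSpace ℝ (Fin d) →ₗ[ℝ] EuclideanSpace ℝ (Fin d)) =
      (realInv (B n)).conjTranspose.toEuclideanLin := LinearMap.ext fun x => rfl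
    rw [this, hdet, abs_inv, absDet]
  have hTc : ∀ n, Continuous (T n) := fun n => (T n).toLinearMap.continuous_of_finiteDimensional
  have hcf : ∀ n x, charFun (invMap (B n) (convPow μ n) : Measure (EuclideanSpace ℝ (Fin d))) x =
      charFun P (T n x) ^ n := fun n x => by
    rw [charFun_invMap, charFun_map_convPow, hTapply]
  set φ := charFun (η : Measure (EuclideanSpace ℝ (Fin d))) with hφ
  have hφc : Continuous φ := continuous_charFun
  have hφ0 : φ 0 = 1 := by simp [hφ]
  -- Two errors of `1 / 4` keep the powers within `1 / 2` of `1`, where the principal logarithm has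
  -- norm at most `3 / 4 < π`.
  obtain ⟨r, hr, hφr⟩ : ∃ r > 0, ∀ x, ‖x‖ ≤ r → ‖φ x - 1‖ ≤ 1 / 4 := by
    obtain ⟨ρ, hρ, h⟩ := Metric.continuousAt_iff.1 hφc.continuousAt (1 / 4) (by norm_num)
    refine ⟨ρ / 2, half_pos hρ, fun x hx => ?_⟩
    have := h (x := x) (by rw [dist_zero_right]; linarith)
    rw [hφ0, dist_eq_norm] at this
    exact this.le
  have hpt := ProbabilityMeasure.tendsto_iff_tendsto_charFun.1 hC.tendsto
  have hunif : TendstoUniformlyOn (fun n x => charFun P (T n x) ^ n) φ atTop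
      (Metric.closedBall 0 r) := by
    have := tendstoUniformlyOn_charFun hC.tendsto
      (isCompact_closedBall (0 : EuclideanSpace ℝ (Fin d)) r) hpt
    refine this.congr (Eventually.of_forall fun n x _ => ?_)
    exact hcf n x
  obtain ⟨N', hN'⟩ := eventually_atTop.1
    (Metric.tendstoUniformlyOn_iff.1 hunif (1 / 4) (by norm_num))
  set N := max N' 1 with hN
  have hclose : ∀ n, N ≤ n → ∀ x ∈ Metric.closedBall (0 : EuclideanSpace ℝ (Fin d)) r,
      ‖charFun P (T n x) ^ n - 1‖ ≤ 1 / 2 := by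
    intro n hn x hx
    have h1 := hN' n ((le_max_left _ _).trans hn) x hx
    have h2 := hφr x (by simpa using hx)
    rw [dist_comm, dist_eq_norm] at h1
    have h3 := norm_add_le (charFun P (T n x) ^ n - φ x) (φ x - 1)
    rw [sub_add_sub_cancel] at h3
    linarith
  have hlogle : ∀ z : ℂ, ‖z - 1‖ ≤ 1 / 2 → ‖Complex.log z‖ ≤ 3 / 4 := by
    intro z hz
    have := Complex.norm_log_one_add_half_le_self hz
    rw [add_sub_cancel] at this
    linarith
  have hslit : ∀ z ∈ Metric.closedBall (1 : ℂ) (1 / 2), z ∈ Complex.slitPlane := by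
    intro z hz
    rw [Metric.mem_closedBall, dist_eq_norm] at hz
    have := Complex.mem_slitPlane_of_norm_lt_one (hz.trans_lt (by norm_num))
    rwa [add_sub_cancel] at this
  have hφball : ∀ x ∈ Metric.closedBall (0 : EuclideanSpace ℝ (Fin d)) r,
      φ x ∈ Metric.closedBall (1 : ℂ) (1 / 2) := by
    intro x hx
    rw [Metric.mem_closedBall, dist_eq_norm]
    exact (hφr x (by simpa using hx)).trans (by norm_num)
  have hlogc : ContinuousOn Complex.log (Metric.closedBall (1 : ℂ) (1 / 2)) :=
    continuousOn_id.clog hslit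
  refine exists_regVar_of_tendstoUniformlyOn (volume : Measure (EuclideanSpace ℝ (Fin d))) hD hTD
    (ψ := fun n x => Complex.log (charFun P (T n x) ^ n)) (χ := fun x => Complex.log (φ x))
    (N := N) hr ?_ ?_ ?_ ?_ ?_
  · intro m n hm hn x y hx hy hxy
    have hm0 : m ≠ 0 := by have := (le_max_right N' 1).trans hm; omega
    have hn0 : n ≠ 0 := by have := (le_max_right N' 1).trans hn; omega
    have hroot : ∀ k, N ≤ k → k ≠ 0 → ∀ z, ‖z‖ ≤ r →
        charFun P (T k z) = Complex.exp (Complex.log (charFun P (T k z) ^ k) / k) ∧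
        |(Complex.log (charFun P (T k z) ^ k) / k).im| < Real.pi := by
      intro k hk hk0 z hz
      have hz' : z ∈ Metric.closedBall (0 : EuclideanSpace ℝ (Fin d)) r := by simpa using hz
      refine ⟨eq_exp_log_pow_div (f := fun z => charFun P (T k z)) hr.le hk0
        (continuous_charFun.comp (hTc k)).continuousOn (by simp) (hclose k hk) z hz', ?_⟩
      have h1 := hlogle _ (hclose k hk z hz')
      have hk1 : (1 : ℝ) ≤ k := by exact_mod_cast Nat.one_le_iff_ne_zero.2 hk0
      calc |(Complex.log (charFun P (T k z) ^ k) / k).im|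
          ≤ ‖Complex.log (charFun P (T k z) ^ k) / k‖ := Complex.abs_im_le_norm _
        _ = ‖Complex.log (charFun P (T k z) ^ k)‖ / k := by rw [norm_div, Complex.norm_natCast]
        _ ≤ ‖Complex.log (charFun P (T k z) ^ k)‖ := div_le_self (norm_nonneg _) hk1
        _ < Real.pi := by linarith [Real.pi_gt_three]
    obtain ⟨e1, b1⟩ := hroot m hm hm0 y hy
    obtain ⟨e2, b2⟩ := hroot n hn hn0 x hx
    -- Both exponents have imaginary part in `(-π, π)`, so equal exponentials give equal exponents.
    have hexp := e1.symm.trans ((congrArg (charFun P) hxy).trans e2)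
    have hinj := Complex.exp_inj_of_neg_pi_lt_of_le_pi (abs_lt.1 b1).1 (abs_lt.1 b1).2.le
      (abs_lt.1 b2).1 (abs_lt.1 b2).2.le hexp
    have hmC : (m : ℂ) ≠ 0 := Nat.cast_ne_zero.2 hm0
    have hnC : (n : ℂ) ≠ 0 := Nat.cast_ne_zero.2 hn0
    rw [div_eq_div_iff hmC hnC] at hinj
    linear_combination hinj
  · refine UniformContinuousOn.comp_tendstoUniformlyOn_eventually ?_ hφball
      ((isCompact_closedBall (1 : ℂ) (1 / 2)).uniformContinuousOn_of_continuous hlogc) hunif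
    filter_upwards [eventually_ge_atTop N] with n hn x hx
    rw [Metric.mem_closedBall, dist_eq_norm]
    exact hclose n hn x hx
  · exact hlogc.comp hφc.continuousOn hφball
  · simp [hφ0]
  · intro x hx
    by_contra! h
    -- A logarithm vanishing along the radius would put all the mass of `η` on the hyperplane
    -- orthogonal to `x`.
    have hone : ∀ s ∈ Icc (0 : ℝ) 1, φ (s • x) = 1 := by
      intro s hs
      have hmem := hφball (s • x) (by simpa using norm_smul_le_of_mem_Icc hs hx.le)
      rw [← Complex.exp_log (Complex.slitPlane_ne_zero (hslit _ hmem)), h s hs, Complex.exp_zero]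
    refine hη (ℝ ∙ x)ᗮ (fun htop => ?_) (measure_ker_inner_eq_one η hone)
    have hxm : x ∈ (ℝ ∙ x)ᗮ := htop ▸ Submodule.mem_top
    rw [Submodule.mem_orthogonal_singleton_iff_inner_left, inner_self_eq_zero] at hxm
    rw [hxm, norm_zero] at hx
    exact hr.ne hx

end OccupationScaling

/-! ### The theorem: `a` unbounded or eventually constant -/

open OccupationScaling

theorem mainTheorem11 (d : ℕ) (hd : 0 < d)
    (μ : ProbabilityMeasure (Fin d → ℤ))
    (B : ℕ → Matrix (Fin d) (Fin d) ℤ)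
    (η : ProbabilityMeasure (EuclideanSpace ℝ (Fin d)))
    (hη : OccupationScaling.Adapted η)
    (hC : OccupationScaling.ConvergenceAssumption μ B η)
    (F : ℝ → ℝ) (a : ℕ → ℕ) (F' : ℝ → ℝ)
    (hS : OccupationScaling.ScalingAssumption B F a F') :
    ∃ γ : ℝ, 0 ≤ γ ∧ γ ≤ 1 ∧ (∀ y : ℝ, 0 < y → F' y = F' 1 * y ^ γ) ∧
      ∃ κ : ℝ, 0 ≤ κ ∧ (γ < 1 → 0 < κ) ∧
        (∀ l : ℝ, 0 < l →
          Tendsto (fun n : ℕ => (a ⌊l * (n : ℝ)⌋₊ : ℝ) / (a n : ℝ)) atTop (𝓝 (l ^ κ))) ∧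
        Tendsto (fun n : ℕ => Real.log (a n : ℝ) / Real.log (n : ℝ)) atTop (𝓝 κ) := by
  have hD : ∀ n, 0 < absDet (B n) := fun n => absDet_pos (hC.det_ne_zero n)
  obtain ⟨⟨C, hC0, hDmono⟩, g, hg⟩ := exists_regVar_absDet hη hC
  obtain ⟨δ, hδ, hreg⟩ := hg.exists_rpow (Eventually.of_forall hD) hC0 hDmono
  have hlim : ∀ y, 0 < y →
      Tendsto (fun n => rescale (fun n => absDet (B n)) F a n y) atTop (𝓝 (F' y)) :=
    fun y hy => (hS.tendsto {y} isCompact_singleton (singleton_subset_iff.2 hy)).tendsto_at rfl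
  have hQ := antitoneOn_div_id_of_concaveOn hS.concave hS.map_zero.ge
  have hM' := limit_monotoneOn hD hS.monotone hlim
  have hQ' := limit_div_antitoneOn hD hQ hlim
  obtain ⟨y₀, hy₀, hne⟩ := hS.limit_ne_zero
  have hpos : ∀ y, 0 < y → 0 < F' y := fun y hy =>
    pos_of_monotoneOn_of_div_antitoneOn hM' hQ' hy₀
      (lt_of_le_of_ne (hS.limit_nonneg y₀ hy₀.le) hne.symm) hy
  by_cases ha : Tendsto a atTop atTop
  · have hFc : ContinuousOn F' (Ioi 0) := by
      have hFcont : ContinuousOn F (Ioi 0) := by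
        have := hS.concave.continuousOn_interior
        rwa [interior_Ici] at this
      have hloc : TendstoLocallyUniformlyOn
          (fun n y => rescale (fun n => absDet (B n)) F a n y) F' atTop (Ioi 0) :=
        (tendstoLocallyUniformlyOn_iff_forall_isCompact isOpen_Ioi).2 fun K hK hKc =>
          hS.tendsto K hKc hK
      refine hloc.continuousOn (Eventually.frequently ?_)
      filter_upwards [eventually_gt_atTop 0] with n hn
      refine continuousOn_const.mul (hFcont.comp (by fun_prop) fun y hy => ?_)
      have hy : 0 < y := hy
      have := hD (a n)
      exact mem_Ioi.2 (by positivity)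
    obtain ⟨γ, hγ0, hγ1, hpow, κ, hκ, hκγ, haκ⟩ := exists_power_of_unbounded hD hδ hreg hC0 hDmono
      hS.monotone hQ hlim hFc hpos hS.monotone_seq ha
    refine ⟨γ, hγ0, hγ1, hpow, κ, hκ, hκγ, fun l hl => ?_, ?_⟩
    · exact haκ l hl _ _ (tendsto_floor_mul hl) tendsto_id (tendsto_floor_mul_div hl)
    · exact haκ.tendsto_log_div_log (fun m n hmn => Nat.cast_le.2 (hS.monotone_seq hmn))
        ((ha.eventually_ge_atTop 1).mono fun n hn => by exact_mod_cast hn)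
  · obtain ⟨A, hA⟩ : ∃ A, ∀ᶠ n in atTop, a n = A := by
      rcases tendsto_atTop_of_monotone hS.monotone_seq with h | ⟨A, hA⟩
      · exact absurd h ha
      · exact ⟨A, by simpa using hA⟩
    -- With `A = 0` the rescaled functions would eventually vanish, whereas `F' 1 > 0`.
    have hA0 : A ≠ 0 := by
      rintro rfl
      refine (hpos 1 one_pos).ne (tendsto_nhds_unique (tendsto_const_nhds.congr' ?_) (hlim 1 one_pos))
      filter_upwards [hA] with n hn
      simp [rescale, hn]
    refine ⟨1, zero_le_one, le_rfl, fun y hy => ?_, 0, le_rfl, fun h => absurd h (lt_irrefl 1),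
      fun l hl => ?_, ?_⟩
    · rw [Real.rpow_one]
      exact limit_linear_of_eventually_const hD hS.nonneg hQ hlim hA hy
    · rw [Real.rpow_zero]
      refine tendsto_const_nhds.congr' ?_
      filter_upwards [hA, (tendsto_floor_mul hl).eventually hA] with n h1 h2
      rw [h1, h2, div_self (Nat.cast_ne_zero.2 hA0)]
    · have h0 : Tendsto (fun n : ℕ => Real.log (A : ℝ) / Real.log (n : ℝ)) atTop (𝓝 0) :=
        tendsto_const_nhds.div_atTop (Real.tendsto_log_atTop.comp tendsto_natCast_atTop_atTop)
      refine h0.congr' ?_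
      filter_upwards [hA] with n hn
      rw [hn]
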